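/- **Conventions.** Let $x=x(u,v)$ be a smooth ($C^\infty$) regular surface in $\mathbb R^3$ on a connected open set, with coefficients $E,F,G$ and $L,M,N$ of the first and second fundamental forms, where $L=\langle x_{uu},l\rangle$, $M=\langle x_{uv},l\rangle$, $N=\langle x_{vv},l\rangle$ and the unit normal is $l=\frac{x_u\times x_v}{|x_u\times x_v|}$. The parameters are *principal* if $F=M=0$. Then $X=\frac{x_u}{\sqrt E}$, $Y=\frac{x_v}{\sqrt G}$, $l$ is a right oriented orthonormal frame, $\nu_1=\frac LE$, $\nu_2=\frac NG$ are the principal curvatures, and $\gamma_1,\gamma_2$ denote the geodesic curvatures (with respect to $l$) of the lines $v=\mathrm{const}$ and $u=\mathrm{const}$, respectively. The surface, in principal parameters, is *strongly regular* if $(\nu_1-\nu_2)\gamma_1\gamma_2\neq0$ everywhere. A strongly regular surface with $\nu_1=f(\nu)$, $\nu_2=g(\nu)$, where $f-g>0$, $f'g'\ne0$, $\nu=\nu(u,v)$, $\nu_u\nu_v\neq 0$, is in *geometric principal parameters* if the functions $\ln\left(\sqrt E\,\exp\int\frac{f'\,d\nu}{f-g}\right)$ and $\ln\left(\sqrt G\,\exp\int\frac{g'\,d\nu}{g-f}\right)$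 of $(u,v)$ are constant. For a strongly regular surface of constant Gaussian curvature $K=\pm1$ with $\nu_1-\nu_2>0$ (take $\nu=\nu_1$, $f(\nu)=\nu$, $g(\nu)=K/\nu$), geometric principal parameters are *canonical* if, moreover, $E=\frac{\varepsilon}{\nu^2-K}$ and $G=\frac{\varepsilon\nu^2}{\nu^2-K}$, where $\varepsilon=\operatorname{sign}(\nu^2-K)$. **Statement.** Let $K=1$ or $K=-1$, let $\mathcal D\subset\mathbb R^2$ be an open neighborhood of $(u_0,v_0)$, let $\nu:\mathcal D\to\mathbb R$ be a smooth function with $\nu(\nu^2-K)>0$ and $\nu_u\nu_v\neq0$ on $\mathcal D$, and put $\varepsilon=\operatorname{sign}(\nu^2-K)$. Suppose that on $\mathcal D$ $$\nu_{vv}+K\nu_{uu}-\frac{2\nu}{\nu^2-K}\left(\nu_v^2+K\nu_u^2\right)=\varepsilon K\nu .$$ Let $x_0\in\mathbb R^3$ and let $X_0,Y_0,l_0$ be a right oriented orthonormal basis of $\mathbb R^3$. Then there is a connected open set $\mathcal D_0$ with $(u_0,v_0)\in\mathcal D_0\subset\mathcal D$ and a strongly regular surface $S:\ x=x(u,v)$,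 $(u,v)\in\mathcal D_0$, such that (i) $(u,v)$ are canonical principal parameters; (ii) $x(u_0,v_0)=x_0$, $X(u_0,v_0)=X_0$, $Y(u_0,v_0)=Y_0$, $l(u_0,v_0)=l_0$; (iii) $S$ has constant Gaussian curvature $K$, and its invariants are $$\nu_1=\nu,\qquad \nu_2=\frac K\nu,\qquad \gamma_1=\frac{\nu_v}{\sqrt{\varepsilon(\nu^2-K)}},\qquad \gamma_2=\frac{-\varepsilon K\nu_u}{\nu\sqrt{\varepsilon(\nu^2-K)}} .$$ The surface is unique: on any connected open set $\mathcal D_1$ with $(u_0,v_0)\in\mathcal D_1\subset\mathcal D$, any two strongly regular surfaces satisfying (i)–(iii) coincide. -/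

import Mathlib

open scoped ContDiff

noncomputable section

namespace CanonicalSurface

/-- Euclidean three-space. -/
abbrev E3 : Type := EuclideanSpace ℝ (Fin 3)

/-- The vector product of Euclidean three-space. -/
def cross (a b : E3) : E3 :=
  WithLp.toLp 2 (crossProduct (WithLp.ofLp a) (WithLp.ofLp b))

/-- A right oriented orthonormal triple of vectors. -/
def IsRightFrame (X Y l : E3) : Prop :=
  Orthonormal ℝ ![X, Y, l] ∧
    0 < Matrix.det (Matrix.of ![WithLp.ofLp X, WithLp.ofLp Y, WithLp.ofLp l])

/-- Partial derivative with respect to the first parameter `u`. -/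
def du {V : Type*} [NormedAddCommGroup V] [NormedSpace ℝ V] (f : ℝ × ℝ → V) (p : ℝ × ℝ) : V :=
  fderiv ℝ f p (1, 0)

/-- Partial derivative with respect to the second parameter `v`. -/
def dv {V : Type*} [NormedAddCommGroup V] [NormedSpace ℝ V] (f : ℝ × ℝ → V) (p : ℝ × ℝ) : V :=
  fderiv ℝ f p (0, 1)

/-- `x` restricted to the connected open set `D` is a smooth regular parametrized surface. -/
structure IsSurface (x : ℝ × ℝ → E3) (D : Set (ℝ × ℝ)) : Prop where
  isOpen : IsOpen D
  isConnected : IsConnected D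
  smooth : ContDiffOn ℝ ∞ x D
  regular : ∀ p ∈ D, LinearIndependent ℝ ![du x p, dv x p]

/-- First fundamental form, coefficient `E`. -/
def fE (x : ℝ × ℝ → E3) (p : ℝ × ℝ) : ℝ := inner ℝ (du x p) (du x p)

/-- First fundamental form, coefficient `F`. -/
def fF (x : ℝ × ℝ → E3) (p : ℝ × ℝ) : ℝ := inner ℝ (du x p) (dv x p)

/-- First fundamental form, coefficient `G`. -/
def fG (x : ℝ × ℝ → E3) (p : ℝ × ℝ) : ℝ := inner ℝ (dv x p) (dv x p)

/-- The unit normal `l` for which `x_u, x_v, l` is positively oriented. -/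
def normal (x : ℝ × ℝ → E3) (p : ℝ × ℝ) : E3 :=
  ‖cross (du x p) (dv x p)‖⁻¹ • cross (du x p) (dv x p)

/-- Second fundamental form, coefficient `L`. -/
def sL (x : ℝ × ℝ → E3) (p : ℝ × ℝ) : ℝ := inner ℝ (du (du x) p) (normal x p)

/-- Second fundamental form, coefficient `M`. -/
def sM (x : ℝ × ℝ → E3) (p : ℝ × ℝ) : ℝ := inner ℝ (dv (du x) p) (normal x p)

/-- Second fundamental form, coefficient `N`. -/
def sN (x : ℝ × ℝ → E3) (p : ℝ × ℝ) : ℝ := inner ℝ (dv (dv x) p) (normal x p)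

/-- The Gaussian curvature. -/
def gaussCurvature (x : ℝ × ℝ → E3) (p : ℝ × ℝ) : ℝ :=
  (sL x p * sN x p - sM x p ^ 2) / (fE x p * fG x p - fF x p ^ 2)

/-- The unit tangent field `X = x_u / √E`. -/
def frameX (x : ℝ × ℝ → E3) (p : ℝ × ℝ) : E3 := (Real.sqrt (fE x p))⁻¹ • du x p

/-- The unit tangent field `Y = x_v / √G`. -/
def frameY (x : ℝ × ℝ → E3) (p : ℝ × ℝ) : E3 := (Real.sqrt (fG x p))⁻¹ • dv x p

/-- The parametric lines are lines of curvature: `F = M = 0`. -/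
def IsPrincipalNet (x : ℝ × ℝ → E3) (D : Set (ℝ × ℝ)) : Prop :=
  ∀ p ∈ D, fF x p = 0 ∧ sM x p = 0

/-- Normal curvature of the `u`-lines; the first principal curvature in principal parameters. -/
def nu1 (x : ℝ × ℝ → E3) (p : ℝ × ℝ) : ℝ := sL x p / fE x p

/-- Normal curvature of the `v`-lines; the second principal curvature in principal parameters. -/
def nu2 (x : ℝ × ℝ → E3) (p : ℝ × ℝ) : ℝ := sN x p / fG x p

/-- Geodesic curvature of the `u`-lines: `⟨c'', l × c'⟩ / |c'|³` for the curve `c = x(·, v)`. -/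
def gamma1 (x : ℝ × ℝ → E3) (p : ℝ × ℝ) : ℝ :=
  inner ℝ (du (du x) p) (cross (normal x p) (du x p)) / ‖du x p‖ ^ 3

/-- Geodesic curvature of the `v`-lines: `⟨c'', l × c'⟩ / |c'|³` for the curve `c = x(u, ·)`. -/
def gamma2 (x : ℝ × ℝ → E3) (p : ℝ × ℝ) : ℝ :=
  inner ℝ (dv (dv x) p) (cross (normal x p) (dv x p)) / ‖dv x p‖ ^ 3

/-- A strongly regular surface, in principal parameters. -/
structure IsStronglyRegular (x : ℝ × ℝ → E3) (D : Set (ℝ × ℝ)) : Prop where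
  isSurface : IsSurface x D
  principal : IsPrincipalNet x D
  stronglyRegular : ∀ p ∈ D, (nu1 x p - nu2 x p) * gamma1 x p * gamma2 x p ≠ 0

/-- `x` is a strongly regular Weingarten surface in principal parameters, with
`ν₁ = f ∘ ν`, `ν₂ = g ∘ ν`. -/
structure IsWeingarten (f g : ℝ → ℝ) (ν : ℝ × ℝ → ℝ) (x : ℝ × ℝ → E3) (D : Set (ℝ × ℝ)) :
    Prop where
  stronglyRegular : IsStronglyRegular x D
  curvature_one : ∀ p ∈ D, nu1 x p = f (ν p)
  curvature_two : ∀ p ∈ D, nu2 x p = g (ν p)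
  differentiable : ∀ t ∈ ν '' D, DifferentiableAt ℝ f t ∧ DifferentiableAt ℝ g t
  sub_pos : ∀ t ∈ ν '' D, 0 < f t - g t
  deriv_ne_zero : ∀ t ∈ ν '' D, deriv f t * deriv g t ≠ 0
  partial_ne_zero : ∀ p ∈ D, du ν p * dv ν p ≠ 0

/-- Geometric principal parameters: the functions
`λ = ln (√E exp ∫ f' dν / (f - g))` and `μ = ln (√G exp ∫ g' dν / (g - f))` are constant.
`Φ`, `Ψ` are the indefinite integrals; on the connected set of values of `ν` they are unique up to
an additive constant. -/
def IsGeometricPrincipal (f g : ℝ → ℝ) (ν : ℝ × ℝ → ℝ) (x : ℝ × ℝ → E3) (D : Set (ℝ × ℝ)) :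
    Prop :=
  IsWeingarten f g ν x D ∧
    ∃ Φ Ψ : ℝ → ℝ,
      (∀ t ∈ ν '' D, HasDerivAt Φ (deriv f t / (f t - g t)) t) ∧
      (∀ t ∈ ν '' D, HasDerivAt Ψ (deriv g t / (g t - f t)) t) ∧
      (∃ c : ℝ, ∀ p ∈ D, Real.log (Real.sqrt (fE x p) * Real.exp (Φ (ν p))) = c) ∧
      (∃ c : ℝ, ∀ p ∈ D, Real.log (Real.sqrt (fG x p) * Real.exp (Ψ (ν p))) = c)

/-- Canonical principal parameters on a strongly regular surface with `ν₁ ν₂ = K`: the geometric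
principal parameters (for `ν = ν₁`, `f(ν) = ν`, `g(ν) = K / ν`) which are normalized by
`E = ε / (ν² - K)`, `G = ε ν² / (ν² - K)`, where `ε = sign (ν² - K)`. -/
structure IsCanonicalPrincipal (K : ℝ) (x : ℝ × ℝ → E3) (D : Set (ℝ × ℝ)) : Prop where
  geometric : IsGeometricPrincipal (fun t => t) (fun t => K / t) (nu1 x) x D
  coeff_E : ∀ p ∈ D, fE x p = Real.sign (nu1 x p ^ 2 - K) / (nu1 x p ^ 2 - K)
  coeff_G : ∀ p ∈ D,
    fG x p = Real.sign (nu1 x p ^ 2 - K) * nu1 x p ^ 2 / (nu1 x p ^ 2 - K)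

/-- `x` on `D` is a strongly regular surface of constant Gaussian curvature `K` in canonical
principal parameters, with the prescribed frame `x₀ X₀ Y₀ l₀` at `p₀`, and with the four
invariants expressed through `ν`. -/
structure IsSolution (K : ℝ) (ν : ℝ × ℝ → ℝ) (p₀ : ℝ × ℝ) (x₀ X₀ Y₀ l₀ : E3)
    (x : ℝ × ℝ → E3) (D : Set (ℝ × ℝ)) : Prop where
  stronglyRegular : IsStronglyRegular x D
  canonical : IsCanonicalPrincipal K x D
  init_x : x p₀ = x₀
  init_X : frameX x p₀ = X₀
  init_Y : frameY x p₀ = Y₀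
  init_l : normal x p₀ = l₀
  gauss : ∀ p ∈ D, gaussCurvature x p = K
  inv_nu1 : ∀ p ∈ D, nu1 x p = ν p
  inv_nu2 : ∀ p ∈ D, nu2 x p = K / ν p
  inv_gamma1 : ∀ p ∈ D,
    gamma1 x p = dv ν p / Real.sqrt (Real.sign (ν p ^ 2 - K) * (ν p ^ 2 - K))
  inv_gamma2 : ∀ p ∈ D,
    gamma2 x p = -(Real.sign (ν p ^ 2 - K) * K * du ν p) /
      (ν p * Real.sqrt (Real.sign (ν p ^ 2 - K) * (ν p ^ 2 - K)))

end CanonicalSurface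

end

/-! The statement is Bonnet's theorem with the coefficients written through a single function. In
principal parameters the position vector and the frame `X`, `Y`, `l` satisfy a linear total
differential system whose coefficients are `√E`, `√G`, `√E γ₁`, `√E ν₁`, `√G γ₂`, `√G ν₂`. In
canonical parameters all six are explicit in `ν`, `ν_u`, `ν_v`. Of the integrability conditions, the
two for `x` and the two Codazzi equations are then identities in `ν`, while the Gauss equation is
`E` times the given differential equation (`exists_isFramedSurface_of_canonical_equation`).

Local existence is the Frobenius theorem for linear systems (`exists_hasFDerivAt_of_flat`). The
system is solved as an ordinary differential equation along every ray from the base point, and `f p`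
is the value at the end of the ray to `p`. Flatness and Grönwall's inequality show that the
solutions on neighbouring rays differ by the prescribed differential up to a quadratic error, so `f`
is differentiable with that differential.

The connection matrix is skew, so `‖X‖² + ‖Y‖² + ‖Z‖²` is constant for every solution of the frame
equations (`IsMovingFrame.sum_norm_sq_eq`). Applied to the difference of two solutions, this is
uniqueness. Applied to the difference between a frame and the triple of its vector products, it
keeps the frame orthonormal and right oriented (`IsMovingFrame.isRightFrame`).

For uniqueness of the surface, `isFramedSurface_of_isPrincipalNet` shows that any surface in
principal parameters satisfies the derivation equations. For a solution the coefficients are forced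
by `ν`, and the initial data agree. -/

noncomputable section

namespace CanonicalSurface

open Set Metric Filter Topology

/-! ### Frobenius theorem for linear total differential equations. -/

section TotalDifferentialEquation

variable {E : Type*} [NormedAddCommGroup E] [NormedSpace ℝ E]
  {V : Type*} [NormedAddCommGroup V] [NormedSpace ℝ V]

/-- Local second order Taylor bounds for a `C²` map. -/
theorem exists_ball_taylor_bounds {W : Type*} [NormedAddCommGroup W] [NormedSpace ℝ W]
    {Ω : E → W} {D : Set E} (hD : IsOpen D) {p₀ : E} (hp₀ : p₀ ∈ D) (hΩ : ContDiffOn ℝ 2 Ω D) :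
    ∃ R > 0, ball p₀ R ⊆ D ∧ ∃ M > 0, (∀ p ∈ ball p₀ R, ‖Ω p‖ ≤ M) ∧
      (∀ p ∈ ball p₀ R, ∀ q ∈ ball p₀ R, ‖Ω q - Ω p‖ ≤ M * ‖q - p‖) ∧
      (∀ p ∈ ball p₀ R, ∀ q ∈ ball p₀ R,
        ‖Ω q - Ω p - fderiv ℝ Ω p (q - p)‖ ≤ M * ‖q - p‖ ^ 2) := by
  have hDn : D ∈ 𝓝 p₀ := hD.mem_nhds hp₀
  have h2 : ContDiffAt ℝ 2 Ω p₀ := hΩ.contDiffAt hDn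
  have h1 : ContDiffAt ℝ 1 (fderiv ℝ Ω) p₀ := h2.fderiv_right (by norm_num)
  obtain ⟨K, t, ht, hK⟩ := h1.exists_lipschitzOnWith
  obtain ⟨K', t', ht', hK'⟩ := (h2.of_le (by norm_num : (1 : ℕ∞ω) ≤ 2)).exists_lipschitzOnWith
  have hb : ∀ᶠ p in 𝓝 p₀, ‖Ω p‖ < ‖Ω p₀‖ + 1 :=
    h2.continuousAt.norm.eventually_lt_const (by linarith)
  obtain ⟨R, hR, hsub⟩ := Metric.mem_nhds_iff.1 (inter_mem (inter_mem hDn hb) (inter_mem ht ht'))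
  refine ⟨R, hR, fun p hp => (hsub hp).1.1, ‖Ω p₀‖ + 1 + K + K', by positivity, ?_, ?_, ?_⟩
  · intro p hp
    have := (hsub hp).1.2
    simp only [mem_ofPred_eq] at this
    linarith [K.2, K'.2, K.coe_nonneg, K'.coe_nonneg]
  · intro p hp q hq
    have := hK'.norm_sub_le (hsub hq).2.2 (hsub hp).2.2
    refine this.trans (mul_le_mul_of_nonneg_right ?_ (norm_nonneg _))
    linarith [norm_nonneg (Ω p₀), K.coe_nonneg]
  · intro p hp q hq
    have hconv : segment ℝ p q ⊆ ball p₀ R := (convex_ball p₀ R).segment_subset hp hq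
    -- Mean value inequality for `Ω` minus its linearization at `p`: the derivative of this
    -- difference is at most `K * ‖q - p‖` on the segment, because `fderiv ℝ Ω` is Lipschitz.
    have key := Convex.norm_image_sub_le_of_norm_hasFDerivWithin_le' (𝕜 := ℝ) (f := Ω)
      (f' := fderiv ℝ Ω) (φ := fderiv ℝ Ω p) (C := K * ‖q - p‖) (s := segment ℝ p q)
      (x := p) (y := q)
      (fun x hx => (((hΩ.contDiffAt (hD.mem_nhds (hsub (hconv hx)).1.1)).differentiableAt
        (by norm_num)).hasFDerivAt).hasFDerivWithinAt)
      (fun x hx => by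
        refine (hK.norm_sub_le (hsub (hconv hx)).2.1 (hsub hp).2.1).trans ?_
        refine mul_le_mul_of_nonneg_left ?_ K.coe_nonneg
        simpa [norm_sub_rev] using norm_sub_le_of_mem_segment hx)
      (convex_segment p q) (left_mem_segment ℝ p q) (right_mem_segment ℝ p q)
    refine key.trans ?_
    rw [mul_assoc, ← sq]
    refine mul_le_mul_of_nonneg_right ?_ (sq_nonneg _)
    linarith [norm_nonneg (Ω p₀), K'.coe_nonneg]

theorem hasDerivAt_comp_ray {W : Type*} [NormedAddCommGroup W] [NormedSpace ℝ W] {Ω : E → W}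
    {Ω' : E →L[ℝ] W} {p q : E} {t : ℝ} (h : HasFDerivAt Ω Ω' (p + t • q)) :
    HasDerivAt (fun s : ℝ => Ω (p + s • q)) (Ω' q) t := by
  have hray : HasDerivAt (fun s : ℝ => p + s • q) q t := by
    simpa using ((hasDerivAt_id t).smul_const q).const_add p
  exact h.comp_hasDerivAt t hray

/-- A linear differential equation along a short segment has a solution on the whole segment. -/
theorem exists_linear_ode_solution [CompleteSpace V] {A : ℝ → V →L[ℝ] V}
    (hA : ContinuousOn A (Icc 0 1)) (hA2 : ∀ t ∈ Icc (0 : ℝ) 1, ‖A t‖ ≤ 1 / 2) (y₀ : V) :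
    ∃ F : ℝ → V, F 0 = y₀ ∧
      ∀ t ∈ Icc (0 : ℝ) 1, HasDerivWithinAt F (A t (F t)) (Icc 0 1) t := by
  -- In the ball of radius `‖y₀‖ + 1` about `y₀` one has `‖y‖ ≤ 2‖y₀‖ + 1`, so the speed is at most
  -- `‖y₀‖ + 1/2`. The curve cannot leave the ball in unit time, which gives a solution on all of
  -- `[0, 1]`.
  have hP : IsPicardLindelof (fun t y => A t y) (⟨0, by simp⟩ : Icc (0 : ℝ) 1) y₀
      (‖y₀‖₊ + 1) 0 (‖y₀‖₊ + 1) 1 := by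
    refine ⟨?_, ?_, ?_, ?_⟩
    · intro t ht
      have : LipschitzWith 1 (A t) := (A t).lipschitz.weaken (by
        rw [← NNReal.coe_le_coe]
        exact (hA2 t ht).trans (by norm_num))
      exact this.lipschitzOnWith
    · intro y _
      exact hA.clm_apply continuousOn_const
    · intro t ht y hy
      have h1 : ‖y‖ ≤ ‖y₀‖ + (‖y₀‖ + 1) := by
        have := mem_closedBall_iff_norm.1 hy
        have h2 := norm_le_insert' y y₀
        push_cast at this
        linarith
      have h3 := (A t).le_of_opNorm_le (hA2 t ht) y
      push_cast
      linarith
    · simp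
  exact hP.exists_eq_forall_mem_Icc_hasDerivWithinAt₀

/-- The error term that compares the solutions along two neighbouring rays. -/
theorem norm_ray_error_le {P Q d : E →L[ℝ] V →L[ℝ] V} {M B t : ℝ} {q h : E} {y z w : V}
    (ht0 : 0 ≤ t) (ht1 : t ≤ 1) (hq : ‖q‖ ≤ 1) (hqh : ‖q + h‖ ≤ 1)
    (hP : ‖P‖ ≤ M) (hQP : ‖Q - P‖ ≤ M * ‖h‖) (hd : ‖Q - P - t • d‖ ≤ M * ‖h‖ ^ 2)
    (hQqh : ‖Q (q + h)‖ ≤ 1) (hy : ‖y‖ ≤ B)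
    (hw : w = d q y + P q (P h y)) :
    ‖Q (q + h) z - P q y - (t • w + P h y)‖ ≤
      1 * ‖z - y - t • P h y‖ + (2 * M * B + 2 * M * M * B) * ‖h‖ ^ 2 := by
  have hB : 0 ≤ B := (norm_nonneg y).trans hy
  -- Every term after the first is quadratic in `h`. The form of `w` matters: its term `d q y` is
  -- what turns `Q - P` into the second order Taylor remainder `Q - P - t • d`.
  have hdecomp : Q (q + h) z - P q y - (t • w + P h y) =
      Q (q + h) (z - y - t • P h y) + ((Q - P - t • d) q y + (Q - P) h y
        + t • ((Q - P) (q + h) (P h y) + P h (P h y))) := by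
    rw [hw]
    simp only [map_add, map_sub, map_smul, add_apply,
      sub_apply, smul_apply, smul_add, smul_sub]
    abel
  have happ : ∀ (T : E →L[ℝ] V →L[ℝ] V) (a b c : ℝ) (x : E) (v : V), ‖T‖ ≤ a → ‖x‖ ≤ b →
      ‖v‖ ≤ c → ‖T x v‖ ≤ a * b * c := fun T a b c x v ha hb hc => by
    have ha0 := (norm_nonneg T).trans ha
    have hb0 := (norm_nonneg x).trans hb
    exact (T.le_opNorm₂ x v).trans (by gcongr)
  have e0 : ‖P h y‖ ≤ M * ‖h‖ * B := happ _ _ _ _ _ _ hP le_rfl hy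
  have e1 := (Q (q + h)).le_of_opNorm_le hQqh (z - y - t • P h y)
  have e2 := happ _ _ _ _ _ _ hd hq hy
  have e3 := happ _ _ _ _ h _ hQP le_rfl hy
  have e4 := happ _ _ _ _ _ _ hQP hqh e0
  have e5 := happ _ _ _ _ h _ hP le_rfl e0
  have e6 : ‖t • ((Q - P) (q + h) (P h y) + P h (P h y))‖ ≤
      ‖(Q - P) (q + h) (P h y)‖ + ‖P h (P h y)‖ := by
    rw [norm_smul, Real.norm_of_nonneg ht0]
    exact (mul_le_of_le_one_left (norm_nonneg _) ht1).trans (norm_add_le _ _)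
  rw [hdecomp]
  refine (norm_add_le _ _).trans (add_le_add e1 ((norm_add_le _ _).trans ?_))
  have e7 := norm_add_le ((Q - P - t • d) q y) ((Q - P) h y)
  nlinarith

/-- **Frobenius theorem** for linear total differential equations `df = Ω f`. -/
theorem exists_hasFDerivAt_of_flat [CompleteSpace V] {Ω : E → E →L[ℝ] V →L[ℝ] V} {D : Set E}
    (hD : IsOpen D) {p₀ : E} (hp₀ : p₀ ∈ D) (hΩ : ContDiffOn ℝ 2 Ω D)
    (hflat : ∀ p ∈ D, ∀ q h : E, fderiv ℝ Ω p q h + (Ω p h).comp (Ω p q) =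
      fderiv ℝ Ω p h q + (Ω p q).comp (Ω p h)) (y₀ : V) :
    ∃ R > 0, ball p₀ R ⊆ D ∧ ∃ f : E → V, f p₀ = y₀ ∧
      ∀ p ∈ ball p₀ R, HasFDerivAt f ((Ω p).flip (f p)) p := by
  obtain ⟨R₁, hR₁, hsub, M, hM, hbd, hlip, htay⟩ := exists_ball_taylor_bounds hD hp₀ hΩ
  -- The bound `1` makes all rays shorter than `1`; the bound `1 / (2M)` gives `‖Ω q‖ ≤ 1/2` along
  -- them, as the existence lemma for the linear equation requires.
  set R := min (min R₁ 1) (1 / (2 * M)) with hRdef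
  have hR : 0 < R := by positivity
  have hRR₁ : R ≤ R₁ := (min_le_left _ _).trans (min_le_left _ _)
  have hR1 : R ≤ 1 := (min_le_left _ _).trans (min_le_right _ _)
  have hRM : M * R ≤ 1 / 2 := by
    have : R ≤ 1 / (2 * M) := min_le_right _ _
    calc M * R ≤ M * (1 / (2 * M)) := by gcongr
      _ = 1 / 2 := by field_simp
  have hmem : ∀ q : E, ‖q‖ < R → ∀ t ∈ Icc (0 : ℝ) 1, p₀ + t • q ∈ ball p₀ R₁ := by
    intro q hq t ht
    rw [mem_ball_iff_norm, add_sub_cancel_left, norm_smul, Real.norm_of_nonneg ht.1]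
    calc t * ‖q‖ ≤ 1 * ‖q‖ := by gcongr; exact ht.2
      _ < R₁ := by linarith
  have hnorm : ∀ q : E, ‖q‖ < R → ∀ t ∈ Icc (0 : ℝ) 1, ‖Ω (p₀ + t • q) q‖ ≤ 1 / 2 := by
    intro q hq t ht
    refine ((Ω (p₀ + t • q)).le_of_opNorm_le (hbd _ (hmem q hq t ht)) q).trans ?_
    refine le_trans ?_ hRM
    gcongr
  have hex : ∀ q : E, ∃ F : ℝ → V, ‖q‖ < R → F 0 = y₀ ∧ ∀ t ∈ Icc (0 : ℝ) 1,
      HasDerivWithinAt F (Ω (p₀ + t • q) q (F t)) (Icc 0 1) t := by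
    intro q
    by_cases hq : ‖q‖ < R
    · obtain ⟨F, hF⟩ := exists_linear_ode_solution (A := fun t => Ω (p₀ + t • q) q) (by
        refine ContinuousOn.clm_apply ?_ continuousOn_const
        exact hΩ.continuousOn.comp (by fun_prop) fun t ht => hsub (hmem q hq t ht))
        (hnorm q hq) y₀
      exact ⟨F, fun _ => hF⟩
    · exact ⟨0, fun h => absurd h hq⟩
  choose F hF using hex
  have hFder : ∀ q : E, ‖q‖ < R → ∀ t ∈ Ico (0 : ℝ) 1,
      HasDerivWithinAt (F q) (Ω (p₀ + t • q) q (F q t)) (Ici t) t := fun q hq t ht =>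
    ((hF q hq).2 t (Ico_subset_Icc_self ht)).mono_of_mem_nhdsWithin
      (mem_of_superset (Icc_mem_nhdsGE ht.2) (Icc_subset_Icc_left ht.1))
  have hFcont : ∀ q : E, ‖q‖ < R → ContinuousOn (F q) (Icc 0 1) := fun q hq t ht =>
    ((hF q hq).2 t ht).continuousWithinAt
  have hFbd : ∀ q : E, ‖q‖ < R → ∀ t ∈ Icc (0 : ℝ) 1, ‖F q t‖ ≤ ‖y₀‖ * Real.exp 1 := by
    intro q hq t ht
    have := norm_le_gronwallBound_of_norm_deriv_right_le (δ := ‖y₀‖) (K := 1) (ε := 0)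
      (hFcont q hq) (hFder q hq) (by rw [(hF q hq).1]) (fun s hs => by
        have := (Ω (p₀ + s • q) q).le_of_opNorm_le (hnorm q hq s (Ico_subset_Icc_self hs)) (F q s)
        linarith [norm_nonneg (F q s)]) t ht
    rw [gronwallBound_ε0] at this
    refine this.trans ?_
    gcongr
    simpa using ht.2
  set B := ‖y₀‖ * Real.exp 1 with hB
  have hB0 : 0 ≤ B := by positivity
  refine ⟨R, hR, (ball_subset_ball hRR₁).trans hsub, fun p => F (p - p₀) 1, ?_, ?_⟩
  · have h0 : ‖(0 : E)‖ < R := by simpa using hR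
    have := constant_of_has_deriv_right_zero (hFcont 0 h0) (fun t ht => by
      simpa using hFder 0 h0 t ht) 1 (by simp)
    simp [this, (hF 0 h0).1]
  intro p hp
  -- the error estimate along the two rays
  have main : ∀ q h : E, ‖q‖ < R → ‖q + h‖ < R →
      ‖F (q + h) 1 - F q 1 - Ω (p₀ + q) h (F q 1)‖ ≤
        (2 * M * B + 2 * M * M * B) * Real.exp 1 * ‖h‖ ^ 2 := by
    intro q h hq hqh
    have hder : ∀ t ∈ Icc (0 : ℝ) 1, HasDerivAt (fun t : ℝ => Ω (p₀ + t • q) h)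
        (fderiv ℝ Ω (p₀ + t • q) q h) t := by
      intro t ht
      have hΩd : HasFDerivAt Ω (fderiv ℝ Ω (p₀ + t • q)) (p₀ + t • q) :=
        ((hΩ.contDiffAt (hD.mem_nhds (hsub (hmem q hq t ht)))).differentiableAt
          (by norm_num)).hasFDerivAt
      have hcomp := hasDerivAt_comp_ray (W := E →L[ℝ] V →L[ℝ] V) (q := q) hΩd
      simpa using hcomp.clm_apply (hasDerivAt_const t h)
    -- `t • h` is the displacement between the two rays at time `t`, so `g t` is the error of the
    -- expected first order variation. It vanishes at `t = 0`, and `‖g'‖ ≤ ‖g‖ + C‖h‖²`.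
    set g : ℝ → V := fun t => F (q + h) t - F q t - t • Ω (p₀ + t • q) h (F q t) with hg
    set g' : ℝ → V := fun t => Ω (p₀ + t • (q + h)) (q + h) (F (q + h) t)
      - Ω (p₀ + t • q) q (F q t) - (t • (fderiv ℝ Ω (p₀ + t • q) q h (F q t)
        + Ω (p₀ + t • q) h (Ω (p₀ + t • q) q (F q t))) + Ω (p₀ + t • q) h (F q t)) with hg'
    have hgd : ∀ t ∈ Ico (0 : ℝ) 1, HasDerivWithinAt g (g' t) (Ici t) t := by
      intro t ht
      have h1 := ((hder t (Ico_subset_Icc_self ht)).hasDerivWithinAt (s := Ici t)).clm_apply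
        (hFder q hq t ht)
      have h2 := (hasDerivWithinAt_id t (Ici t)).smul h1
      have h3 := ((hFder (q + h) hqh t ht).sub (hFder q hq t ht)).sub h2
      refine h3.congr_deriv ?_
      simp [hg']
    have hgc : ContinuousOn g (Icc 0 1) := by
      refine ((hFcont _ hqh).sub (hFcont _ hq)).sub (continuousOn_id.smul ?_)
      refine ContinuousOn.clm_apply (fun t ht => (hder t ht).continuousAt.continuousWithinAt)
        (hFcont _ hq)
    have hbound : ∀ t ∈ Ico (0 : ℝ) 1, ‖g' t‖ ≤
        1 * ‖g t‖ + (2 * M * B + 2 * M * M * B) * ‖h‖ ^ 2 := by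
      intro t ht
      have ht' := Ico_subset_Icc_self ht
      have hPm := hmem q hq t ht'
      have hQm := hmem (q + h) hqh t ht'
      have hQP : (p₀ + t • (q + h)) - (p₀ + t • q) = t • h := by
        rw [add_sub_add_left_eq_sub, ← smul_sub, add_sub_cancel_left]
      have hnQP : ‖(p₀ + t • (q + h)) - (p₀ + t • q)‖ ≤ ‖h‖ := by
        rw [hQP, norm_smul, Real.norm_of_nonneg ht.1]
        exact mul_le_of_le_one_left (norm_nonneg _) ht'.2
      refine norm_ray_error_le (d := fderiv ℝ Ω (p₀ + t • q) h) ht.1 ht'.2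
        (hq.le.trans hR1) (hqh.le.trans hR1) (hbd _ hPm) ?_ ?_
        ((hnorm _ hqh t ht').trans (by norm_num)) (hFbd q hq t ht') ?_
      · exact (hlip _ hPm _ hQm).trans (by gcongr)
      · have := htay _ hPm _ hQm
        rw [hQP, map_smul, ← hQP] at this
        exact this.trans (by gcongr)
      -- The only use of flatness: it replaces the derivative of `Ω` along the ray by its derivative
      -- in the transverse direction `h`, which matches the Taylor expansion between the rays.
      · exact congrArg (fun T => T (F q t)) (hflat _ (hsub hPm) q h)
    have hfin := norm_le_gronwallBound_of_norm_deriv_right_le (δ := 0) (K := 1)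
      hgc hgd (by simp [hg, (hF q hq).1, (hF _ hqh).1]) hbound 1 (by simp)
    rw [gronwallBound_of_K_ne_0 one_ne_zero] at hfin
    have he : g 1 = F (q + h) 1 - F q 1 - Ω (p₀ + q) h (F q 1) := by simp [hg]
    rw [← he]
    refine hfin.trans ?_
    simp only [zero_mul, zero_add, div_one, sub_zero, mul_one]
    have : 0 ≤ (2 * M * B + 2 * M * M * B) * ‖h‖ ^ 2 := by positivity
    linarith
  have hq : ‖p - p₀‖ < R := mem_ball_iff_norm.1 hp
  have hO : (fun x => F (x - p₀) 1 - F (p - p₀) 1 - (Ω p).flip (F (p - p₀) 1) (x - p))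
      =O[𝓝 p] fun x => ‖x - p‖ ^ 2 := by
    refine Asymptotics.IsBigO.of_bound ((2 * M * B + 2 * M * M * B) * Real.exp 1) ?_
    filter_upwards [isOpen_ball.mem_nhds hp] with x hx
    have hx' : p - p₀ + (x - p) = x - p₀ := by abel
    have := main (p - p₀) (x - p) hq (by rw [hx']; exact mem_ball_iff_norm.1 hx)
    rw [hx', add_sub_cancel] at this
    simpa using this
  refine HasFDerivAt.of_isLittleO (hO.trans_isLittleO ?_)
  exact Asymptotics.isLittleO_pow_sub_sub p one_lt_two

/-- A solution of a linear total differential equation is as smooth as the coefficients. -/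
theorem contDiffOn_of_hasFDerivAt_flip {Ω : E → E →L[ℝ] V →L[ℝ] V} {D : Set E} (hD : IsOpen D)
    (hΩ : ContDiffOn ℝ ∞ Ω D) {f : E → V}
    (hf : ∀ p ∈ D, HasFDerivAt f ((Ω p).flip (f p)) p) : ContDiffOn ℝ ∞ f D := by
  rw [contDiffOn_infty]
  intro n
  -- Bootstrap: the differential of `f` is bilinear in `Ω` and `f`, hence as smooth as `f`, which
  -- gains one derivative.
  induction n with
  | zero => exact contDiffOn_zero.2 fun p hp => (hf p hp).continuousAt.continuousWithinAt
  | succ n ih =>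
    push_cast
    rw [contDiffOn_succ_iff_fderiv_of_isOpen hD]
    refine ⟨fun p hp => (hf p hp).differentiableAt.differentiableWithinAt, by simp, ?_⟩
    refine ContDiffOn.congr (f := fun p => (Ω p).flip (f p)) ?_ fun p hp => (hf p hp).fderiv
    refine ContDiffOn.clm_apply ?_ ih
    have hΩn : ContDiffOn ℝ n Ω D := hΩ.of_le (by exact_mod_cast le_top)
    exact ContDiff.comp_contDiffOn (F := E →L[ℝ] V →L[ℝ] V) (G := V →L[ℝ] E →L[ℝ] V)
      (LinearIsometryEquiv.contDiff (E := E →L[ℝ] V →L[ℝ] V) (F := V →L[ℝ] E →L[ℝ] V)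
        (ContinuousLinearMap.flipₗᵢ ℝ E V V)) hΩn

end TotalDifferentialEquation

/-! ### Vector product and right oriented frames in Euclidean three-space. -/

section VectorProduct

theorem inner_eq_sum_coord (a b : E3) : inner ℝ a b = a 0 * b 0 + a 1 * b 1 + a 2 * b 2 := by
  simp only [PiLp.inner_apply, Fin.sum_univ_three, RCLike.inner_apply, conj_trivial]
  ring

theorem cross_coord_zero (a b : E3) : cross a b 0 = a 1 * b 2 - a 2 * b 1 := by
  simp [cross, cross_apply]

theorem cross_coord_one (a b : E3) : cross a b 1 = a 2 * b 0 - a 0 * b 2 := by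
  simp [cross, cross_apply]

theorem cross_coord_two (a b : E3) : cross a b 2 = a 0 * b 1 - a 1 * b 0 := by
  simp [cross, cross_apply]

theorem E3.ext_coord {a b : E3} (h0 : a 0 = b 0) (h1 : a 1 = b 1) (h2 : a 2 = b 2) : a = b := by
  ext i
  fin_cases i <;> assumption

/-- The vector product as a continuous bilinear map. -/
def crossL : E3 →L[ℝ] E3 →L[ℝ] E3 :=
  LinearMap.toContinuousBilinearMap (LinearMap.mk₂ ℝ cross
    (fun a a' b => by
      apply E3.ext_coord <;>
        simp only [cross_coord_zero, cross_coord_one, cross_coord_two, PiLp.add_apply] <;> ring)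
    (fun r a b => by
      apply E3.ext_coord <;>
        simp only [cross_coord_zero, cross_coord_one, cross_coord_two, PiLp.smul_apply,
          smul_eq_mul] <;> ring)
    (fun a b b' => by
      apply E3.ext_coord <;>
        simp only [cross_coord_zero, cross_coord_one, cross_coord_two, PiLp.add_apply] <;> ring)
    (fun r a b => by
      apply E3.ext_coord <;>
        simp only [cross_coord_zero, cross_coord_one, cross_coord_two, PiLp.smul_apply,
          smul_eq_mul] <;> ring))

theorem crossL_apply (a b : E3) : crossL a b = cross a b := rfl

theorem cross_self (a : E3) : cross a a = 0 := by
  apply E3.ext_coord <;>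
    simp only [cross_coord_zero, cross_coord_one, cross_coord_two, PiLp.zero_apply] <;> ring

theorem cross_anticomm (a b : E3) : cross a b = -cross b a := by
  apply E3.ext_coord <;>
    simp only [cross_coord_zero, cross_coord_one, cross_coord_two, PiLp.neg_apply] <;> ring

theorem cross_smul_smul (r s : ℝ) (a b : E3) : cross (r • a) (s • b) = (r * s) • cross a b := by
  simp only [← crossL_apply, map_smul, smul_apply, smul_smul, mul_comm s]

theorem cross_smul_right (s : ℝ) (a b : E3) : cross a (s • b) = s • cross a b := by
  simp only [← crossL_apply, map_smul]

theorem inner_cross_left_self (a b : E3) : inner ℝ (cross a b) a = 0 := by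
  simp only [inner_eq_sum_coord, cross_coord_zero, cross_coord_one, cross_coord_two]; ring

theorem inner_cross_right_self (a b : E3) : inner ℝ (cross a b) b = 0 := by
  simp only [inner_eq_sum_coord, cross_coord_zero, cross_coord_one, cross_coord_two]; ring

theorem inner_cross_cross (a b : E3) : inner ℝ (cross a b) (cross a b) =
    inner ℝ a a * inner ℝ b b - inner ℝ a b ^ 2 := by
  simp only [inner_eq_sum_coord, cross_coord_zero, cross_coord_one, cross_coord_two]; ring

theorem inner_cross_cyclic (a b c : E3) : inner ℝ (cross a b) c = inner ℝ (cross b c) a := by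
  simp only [inner_eq_sum_coord, cross_coord_zero, cross_coord_one, cross_coord_two]; ring

theorem det_eq_inner_cross (a b c : E3) :
    Matrix.det (Matrix.of ![WithLp.ofLp a, WithLp.ofLp b, WithLp.ofLp c]) =
      inner ℝ (cross a b) c := by
  rw [Matrix.det_fin_three]
  simp only [inner_eq_sum_coord, cross_coord_zero, cross_coord_one, cross_coord_two,
    Matrix.of_apply, Matrix.cons_val]
  ring

theorem orthonormal_triple_iff {X Y l : E3} : Orthonormal ℝ ![X, Y, l] ↔
    inner ℝ X X = 1 ∧ inner ℝ Y Y = 1 ∧ inner ℝ l l = 1 ∧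
      inner ℝ X Y = 0 ∧ inner ℝ X l = 0 ∧ inner ℝ Y l = 0 := by
  rw [orthonormal_iff_ite]
  constructor
  · intro h
    exact ⟨by simpa using h 0 0, by simpa using h 1 1, by simpa using h 2 2, by simpa using h 0 1,
      by simpa using h 0 2, by simpa using h 1 2⟩
  · rintro ⟨h1, h2, h3, h4, h5, h6⟩ i j
    fin_cases i <;> fin_cases j <;> simp [h4, h5, h6, real_inner_comm X,
      real_inner_comm Y] <;> simp_all

/-- Expansion of a vector in an orthonormal triple. -/
theorem eq_sum_inner_smul {X Y l : E3} (h : Orthonormal ℝ ![X, Y, l]) (v : E3) :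
    v = (inner ℝ v X : ℝ) • X + (inner ℝ v Y : ℝ) • Y + (inner ℝ v l : ℝ) • l := by
  have hc : Fintype.card (Fin 3) = Module.finrank ℝ E3 := by simp
  have hb : ⇑(OrthonormalBasis.mk h (h.linearIndependent.span_eq_top_of_card_eq_finrank' hc).ge) =
      ![X, Y, l] := OrthonormalBasis.coe_mk _ _
  have := (OrthonormalBasis.mk h
    (h.linearIndependent.span_eq_top_of_card_eq_finrank' hc).ge).sum_repr' v
  rw [hb, Fin.sum_univ_three] at this
  simp only [Matrix.cons_val] at this
  rw [real_inner_comm X, real_inner_comm Y, real_inner_comm l]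
  exact this.symm

theorem IsRightFrame.cyclic {X Y l : E3} (h : IsRightFrame X Y l) : IsRightFrame Y l X := by
  obtain ⟨h1, h2⟩ := h
  rw [det_eq_inner_cross] at h2
  obtain ⟨a, b, c, d, e, f⟩ := orthonormal_triple_iff.1 h1
  refine ⟨orthonormal_triple_iff.2 ⟨b, c, a, f, ?_, ?_⟩, ?_⟩
  · rwa [real_inner_comm]
  · rwa [real_inner_comm]
  · rwa [det_eq_inner_cross, ← inner_cross_cyclic]

/-- The product is orthogonal to `X` and `Y`, hence equals `t • l` with `t` the determinant.
Lagrange's identity gives `t² = 1`, and orientation selects `t = 1`. -/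
theorem IsRightFrame.cross_eq {X Y l : E3} (h : IsRightFrame X Y l) : cross X Y = l := by
  obtain ⟨h1, h2⟩ := h
  rw [det_eq_inner_cross] at h2
  obtain ⟨a, b, c, d, e, f⟩ := orthonormal_triple_iff.1 h1
  have hexp := eq_sum_inner_smul h1 (cross X Y)
  rw [inner_cross_left_self, inner_cross_right_self, zero_smul, zero_smul, zero_add,
    zero_add] at hexp
  have hn := inner_cross_cross X Y
  rw [a, b, d] at hn
  nth_rewrite 2 [hexp] at hn
  rw [inner_smul_right] at hn
  have ht : (inner ℝ (cross X Y) l : ℝ) = 1 := by nlinarith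
  rw [hexp, ht, one_smul]

/-- A nonzero triple, each member of which is the vector product of the other two. -/
theorem isRightFrame_of_cross {X Y l : E3} (hX : X = cross Y l) (hY : Y = cross l X)
    (hl : l = cross X Y) (h0 : X ≠ 0) : IsRightFrame X Y l := by
  have hXY : inner ℝ X Y = 0 := by rw [hX]; exact inner_cross_left_self _ _
  have hXl : inner ℝ X l = 0 := by rw [hX]; exact inner_cross_right_self _ _
  have hYl : inner ℝ Y l = 0 := by rw [hY]; exact inner_cross_left_self _ _
  -- Each squared norm is the product of the other two, so nonnegativity and `X ≠ 0` force all three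
  -- to be `1`.
  have nX : (inner ℝ X X : ℝ) = inner ℝ Y Y * inner ℝ l l := by
    have := inner_cross_cross Y l
    rwa [← hX, hYl, zero_pow two_ne_zero, sub_zero] at this
  have nY : (inner ℝ Y Y : ℝ) = inner ℝ l l * inner ℝ X X := by
    have := inner_cross_cross l X
    rwa [← hY, real_inner_comm X l, hXl, zero_pow two_ne_zero, sub_zero] at this
  have nl : (inner ℝ l l : ℝ) = inner ℝ X X * inner ℝ Y Y := by
    have := inner_cross_cross X Y
    rwa [← hl, hXY, zero_pow two_ne_zero, sub_zero] at this
  have pX : (0 : ℝ) < inner ℝ X X := real_inner_self_pos.2 h0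
  have pY : (0 : ℝ) ≤ inner ℝ Y Y := real_inner_self_nonneg
  have pl : (0 : ℝ) ≤ inner ℝ l l := real_inner_self_nonneg
  have hY1 : (inner ℝ Y Y : ℝ) = 1 := by
    have : (inner ℝ X X : ℝ) * ((inner ℝ Y Y : ℝ) ^ 2 - 1) = 0 := by
      rw [nl] at nX
      linear_combination -nX
    have := (mul_eq_zero.1 this).resolve_left pX.ne'
    nlinarith
  have hlX : (inner ℝ l l : ℝ) = inner ℝ X X := by rw [nl, hY1, mul_one]
  have hX1 : (inner ℝ X X : ℝ) = 1 := by
    rw [hY1, hlX] at nY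
    nlinarith
  refine ⟨orthonormal_triple_iff.2 ⟨hX1, hY1, hlX.trans hX1, hXY, hXl, hYl⟩, ?_⟩
  rw [det_eq_inner_cross, ← hl, hlX, hX1]
  exact one_pos

end VectorProduct

/-! ### Frame equations with a skew connection matrix. -/

section SkewSystem

variable {E : Type*} [NormedAddCommGroup E] [NormedSpace ℝ E]
  {V : Type*} [NormedAddCommGroup V] [InnerProductSpace ℝ V]

/-- The derivation equations of a moving frame, with the connection forms `α`, `β`, `γ`. -/
structure IsMovingFrame (α β γ : E → E →L[ℝ] ℝ) (X Y Z : E → V) (D : Set E) : Prop where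
  hasFDerivAt_fst : ∀ p ∈ D,
    HasFDerivAt X ((α p).smulRight (Y p) + (β p).smulRight (Z p)) p
  hasFDerivAt_snd : ∀ p ∈ D,
    HasFDerivAt Y (-(α p).smulRight (X p) + (γ p).smulRight (Z p)) p
  hasFDerivAt_thd : ∀ p ∈ D,
    HasFDerivAt Z (-(β p).smulRight (X p) - (γ p).smulRight (Y p)) p

theorem IsMovingFrame.sub {α β γ : E → E →L[ℝ] ℝ} {X Y Z X' Y' Z' : E → V} {D : Set E}
    (h : IsMovingFrame α β γ X Y Z D) (h' : IsMovingFrame α β γ X' Y' Z' D) :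
    IsMovingFrame α β γ (fun p => X p - X' p) (fun p => Y p - Y' p) (fun p => Z p - Z' p) D := by
  refine ⟨fun p hp => ?_, fun p hp => ?_, fun p hp => ?_⟩
  · refine ((h.1 p hp).fun_sub (h'.1 p hp)).congr_fderiv ?_
    ext v
    simp
    module
  · refine ((h.2 p hp).fun_sub (h'.2 p hp)).congr_fderiv ?_
    ext v
    simp
    module
  · refine ((h.3 p hp).fun_sub (h'.3 p hp)).congr_fderiv ?_
    ext v
    simp
    module

/-- The connection forms enter with opposite signs, so all terms of the derivative cancel in pairs.
Orthonormality is not assumed, which allows application to differences of frames. -/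
theorem IsMovingFrame.sum_norm_sq_eq {α β γ : E → E →L[ℝ] ℝ} {X Y Z : E → V} {D : Set E}
    (h : IsMovingFrame α β γ X Y Z D) (hD : IsOpen D) (hD' : IsPreconnected D) {p q : E}
    (hp : p ∈ D) (hq : q ∈ D) :
    ‖X p‖ ^ 2 + ‖Y p‖ ^ 2 + ‖Z p‖ ^ 2 = ‖X q‖ ^ 2 + ‖Y q‖ ^ 2 + ‖Z q‖ ^ 2 := by
  have hder : ∀ r ∈ D, HasFDerivAt (fun r => ‖X r‖ ^ 2 + ‖Y r‖ ^ 2 + ‖Z r‖ ^ 2)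
      (0 : E →L[ℝ] ℝ) r := by
    intro r hr
    refine (((h.1 r hr).norm_sq.add (h.2 r hr).norm_sq).add (h.3 r hr).norm_sq).congr_fderiv ?_
    ext v
    simp
    rw [real_inner_comm (X r) (Y r), real_inner_comm (X r) (Z r), real_inner_comm (Y r) (Z r)]
    ring
  exact hD.is_const_of_fderiv_eq_zero hD'
    (fun r hr => (hder r hr).differentiableAt.differentiableWithinAt)
    (fun r hr => (hder r hr).fderiv) hp hq

theorem IsMovingFrame.eq_zero {α β γ : E → E →L[ℝ] ℝ} {X Y Z : E → V} {D : Set E}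
    (h : IsMovingFrame α β γ X Y Z D) (hD : IsOpen D) (hD' : IsPreconnected D) {p₀ : E}
    (hp₀ : p₀ ∈ D) (hX : X p₀ = 0) (hY : Y p₀ = 0) (hZ : Z p₀ = 0) {p : E} (hp : p ∈ D) :
    X p = 0 ∧ Y p = 0 ∧ Z p = 0 := by
  have := h.sum_norm_sq_eq hD hD' hp hp₀
  rw [hX, hY, hZ, norm_zero] at this
  have h1 : ‖X p‖ ^ 2 = 0 := by nlinarith [sq_nonneg ‖X p‖, sq_nonneg ‖Y p‖, sq_nonneg ‖Z p‖]
  have h2 : ‖Y p‖ ^ 2 = 0 := by nlinarith [sq_nonneg ‖X p‖, sq_nonneg ‖Y p‖, sq_nonneg ‖Z p‖]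
  have h3 : ‖Z p‖ ^ 2 = 0 := by nlinarith [sq_nonneg ‖X p‖, sq_nonneg ‖Y p‖, sq_nonneg ‖Z p‖]
  simpa using And.intro h1 (And.intro h2 h3)

theorem hasFDerivAt_cross {a b : E → E3} {a' b' : E →L[ℝ] E3} {p : E} (ha : HasFDerivAt a a' p)
    (hb : HasFDerivAt b b' p) : HasFDerivAt (fun p => cross (a p) (b p))
      ((crossL (a p)).comp b' + (crossL.flip (b p)).comp a') p := by
  refine (crossL.hasFDerivAt_of_bilinear ha hb).congr_fderiv ?_
  ext v
  simp

/-- The product rule for the vector product, together with `cross a a = 0` and anticommutativity,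
reproduces the same skew matrix. A frame can thus be compared with its own triple of products by
linear uniqueness. -/
theorem IsMovingFrame.cross {α β γ : E → E →L[ℝ] ℝ} {X Y Z : E → E3} {D : Set E}
    (h : IsMovingFrame α β γ X Y Z D) :
    IsMovingFrame α β γ (fun p => cross (Y p) (Z p)) (fun p => cross (Z p) (X p))
      (fun p => cross (X p) (Y p)) D := by
  have hs : ∀ a : E3, CanonicalSurface.cross a a = 0 := cross_self
  refine ⟨fun p hp => ?_, fun p hp => ?_, fun p hp => ?_⟩
  · refine (hasFDerivAt_cross (h.2 p hp) (h.3 p hp)).congr_fderiv ?_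
    ext1 v
    simp [crossL_apply, hs]
    rw [cross_anticomm (Y p) (X p), cross_anticomm (X p) (Z p)]
    module
  · refine (hasFDerivAt_cross (h.3 p hp) (h.1 p hp)).congr_fderiv ?_
    ext1 v
    simp [crossL_apply, hs]
    rw [cross_anticomm (Z p) (Y p), cross_anticomm (Y p) (X p)]
    module
  · refine (hasFDerivAt_cross (h.1 p hp) (h.2 p hp)).congr_fderiv ?_
    ext1 v
    simp [crossL_apply, hs]
    rw [cross_anticomm (X p) (Z p), cross_anticomm (Z p) (Y p)]
    module

/-- A moving frame that is a right oriented orthonormal frame at one point is one everywhere. -/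
theorem IsMovingFrame.isRightFrame {α β γ : E → E →L[ℝ] ℝ} {X Y Z : E → E3} {D : Set E}
    (h : IsMovingFrame α β γ X Y Z D) (hD : IsOpen D) (hD' : IsPreconnected D) {p₀ : E}
    (hp₀ : p₀ ∈ D) (h₀ : IsRightFrame (X p₀) (Y p₀) (Z p₀)) {p : E} (hp : p ∈ D) :
    IsRightFrame (X p) (Y p) (Z p) := by
  obtain ⟨h1, h2, h3⟩ := (h.sub h.cross).eq_zero hD hD' hp₀
    (sub_eq_zero.2 h₀.cyclic.cross_eq.symm) (sub_eq_zero.2 h₀.cyclic.cyclic.cross_eq.symm)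
    (sub_eq_zero.2 h₀.cross_eq.symm) hp
  have hsum := h.sum_norm_sq_eq hD hD' hp hp₀
  rw [sub_eq_zero] at h1 h2 h3
  -- If `X p = 0`, the product relations make the whole triple zero at `p`, against the conserved
  -- sum of squares, which is positive at `p₀`.
  refine isRightFrame_of_cross h1 h2 h3 fun h0 => ?_
  have hY : Y p = 0 := by rw [h2, h0, ← crossL_apply, map_zero]
  have hZ : Z p = 0 := by rw [h3, h0, ← crossL_apply, map_zero, zero_apply]
  rw [h0, hY, hZ, norm_zero] at hsum
  have := (orthonormal_triple_iff.1 h₀.1).1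
  rw [real_inner_self_eq_norm_sq] at this
  nlinarith [sq_nonneg ‖Y p₀‖, sq_nonneg ‖Z p₀‖]

end SkewSystem

/-! ### Linear systems in two independent variables. -/

section PlaneSystem

/-- The linear form `r du + s dv`. -/
def coordForm (r s : ℝ) : ℝ × ℝ →L[ℝ] ℝ :=
  r • ContinuousLinearMap.fst ℝ ℝ ℝ + s • ContinuousLinearMap.snd ℝ ℝ ℝ

@[simp]
theorem coordForm_apply (r s : ℝ) (h : ℝ × ℝ) : coordForm r s h = r * h.1 + s * h.2 := by
  simp [coordForm]

theorem fderiv_apply_eq_smul {W : Type*} [NormedAddCommGroup W] [NormedSpace ℝ W]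
    (f : ℝ × ℝ → W) (p h : ℝ × ℝ) : fderiv ℝ f p h = h.1 • du f p + h.2 • dv f p := by
  have : h = h.1 • ((1, 0) : ℝ × ℝ) + h.2 • ((0, 1) : ℝ × ℝ) := by ext <;> simp
  conv_lhs => rw [this]
  rw [map_add, map_smul, map_smul]
  rfl

variable {V : Type*} [NormedAddCommGroup V] [NormedSpace ℝ V]

theorem fderiv_smulRight_add_smulRight_apply {W : Type*} [NormedAddCommGroup W] [NormedSpace ℝ W]
    {A B : ℝ × ℝ → W} {p : ℝ × ℝ} (hA : DifferentiableAt ℝ A p) (hB : DifferentiableAt ℝ B p)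
    (q h : ℝ × ℝ) :
    fderiv ℝ (fun p => (ContinuousLinearMap.fst ℝ ℝ ℝ).smulRight (A p) +
      (ContinuousLinearMap.snd ℝ ℝ ℝ).smulRight (B p)) p q h =
      h.1 • fderiv ℝ A p q + h.2 • fderiv ℝ B p q := by
  have h1 := ((ContinuousLinearMap.smulRightL ℝ (ℝ × ℝ) W
    (ContinuousLinearMap.fst ℝ ℝ ℝ)).hasFDerivAt.comp p hA.hasFDerivAt).add
    ((ContinuousLinearMap.smulRightL ℝ (ℝ × ℝ) W
    (ContinuousLinearMap.snd ℝ ℝ ℝ)).hasFDerivAt.comp p hB.hasFDerivAt)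
  have h2 : HasFDerivAt (fun p => (ContinuousLinearMap.fst ℝ ℝ ℝ).smulRight (A p) +
      (ContinuousLinearMap.snd ℝ ℝ ℝ).smulRight (B p)) _ p := h1
  rw [h2.fderiv]
  simp

/-- The form `A du + B dv` with values in operators. -/
def operatorForm (A B : ℝ × ℝ → V →L[ℝ] V) (p : ℝ × ℝ) : ℝ × ℝ →L[ℝ] V →L[ℝ] V :=
  (ContinuousLinearMap.fst ℝ ℝ ℝ).smulRight (A p) + (ContinuousLinearMap.snd ℝ ℝ ℝ).smulRight (B p)

theorem operatorForm_apply (A B : ℝ × ℝ → V →L[ℝ] V) (p h : ℝ × ℝ) :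
    operatorForm A B p h = h.1 • A p + h.2 • B p := by
  simp [operatorForm]

/-- **Frobenius theorem** for linear systems `f_u = A f`, `f_v = B f` in the plane. -/
theorem exists_hasFDerivAt_operatorForm [CompleteSpace V] {A B : ℝ × ℝ → V →L[ℝ] V}
    {D : Set (ℝ × ℝ)} (hD : IsOpen D) {p₀ : ℝ × ℝ} (hp₀ : p₀ ∈ D) (hA : ContDiffOn ℝ ∞ A D)
    (hB : ContDiffOn ℝ ∞ B D)
    (hcompat : ∀ p ∈ D, dv A p + (A p).comp (B p) = du B p + (B p).comp (A p)) (y₀ : V) :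
    ∃ R > 0, ball p₀ R ⊆ D ∧ ∃ f : ℝ × ℝ → V, f p₀ = y₀ ∧ ContDiffOn ℝ ∞ f (ball p₀ R) ∧
      ∀ p ∈ ball p₀ R, HasFDerivAt f ((operatorForm A B p).flip (f p)) p := by
  have hL : ∀ r : ℝ × ℝ →L[ℝ] ℝ, ∀ C : ℝ × ℝ → V →L[ℝ] V, ContDiffOn ℝ ∞ C D →
      ContDiffOn ℝ ∞ (fun p => r.smulRight (C p)) D := fun r C hC =>
    contDiffOn_const.smulRight hC
  have hΩ : ContDiffOn ℝ ∞ (operatorForm A B) D := (hL _ A hA).add (hL _ B hB)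
  -- After expanding `q` and `h` in coordinates, the terms symmetric in `q` and `h` agree on both
  -- sides, and the rest is a multiple of the single compatibility condition.
  have hflat : ∀ p ∈ D, ∀ q h : ℝ × ℝ,
      fderiv ℝ (operatorForm A B) p q h + (operatorForm A B p h).comp (operatorForm A B p q) =
      fderiv ℝ (operatorForm A B) p h q + (operatorForm A B p q).comp (operatorForm A B p h) := by
    intro p hp q h
    have hd : ∀ q h : ℝ × ℝ, fderiv ℝ (operatorForm A B) p q h =
        h.1 • fderiv ℝ A p q + h.2 • fderiv ℝ B p q :=
      fderiv_smulRight_add_smulRight_apply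
        ((hA.contDiffAt (hD.mem_nhds hp)).differentiableAt (by simp))
        ((hB.contDiffAt (hD.mem_nhds hp)).differentiableAt (by simp))
    have hc := hcompat p hp
    rw [hd, hd]
    simp only [operatorForm_apply, fderiv_apply_eq_smul]
    ext y
    have hcy := congrArg (fun T => T y) hc
    simp only [add_apply, smul_apply, ContinuousLinearMap.comp_apply, map_add, map_smul,
      smul_add] at hcy ⊢
    have e : (dv A p) y = (du B p) y + (B p) ((A p) y) - (A p) ((B p) y) := by
      rw [← hcy]; abel
    rw [e]
    module
  obtain ⟨R, hR, hsub, f, hf0, hf⟩ := exists_hasFDerivAt_of_flat hD hp₀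
    (contDiffOn_infty.1 hΩ 2) hflat y₀
  exact ⟨R, hR, hsub, f, hf0, contDiffOn_of_hasFDerivAt_flip isOpen_ball (hΩ.mono hsub) hf, hf⟩

end PlaneSystem

/-! ### Fundamental theorem of surface theory in principal parameters. -/

section FramedSurface

/-- A parametrized surface `x` in principal parameters with `√E = s₁`, `√G = s₂` and adapted frame
`X, Y, l`, whose derivation equations are `X_u = aY + bl`, `X_v = cY`, `Y_u = -aX`,
`Y_v = -cX + dl`, `l_u = -bX`, `l_v = -dY`. -/
structure IsFramedSurface (s₁ s₂ a b c d : ℝ × ℝ → ℝ) (x X Y l : ℝ × ℝ → E3)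
    (D : Set (ℝ × ℝ)) : Prop where
  hasFDerivAt : ∀ p ∈ D, HasFDerivAt x
    ((coordForm (s₁ p) 0).smulRight (X p) + (coordForm 0 (s₂ p)).smulRight (Y p)) p
  frame : IsMovingFrame (fun p => coordForm (a p) (c p)) (fun p => coordForm (b p) 0)
    (fun p => coordForm 0 (d p)) X Y l D
  right : ∀ p ∈ D, IsRightFrame (X p) (Y p) (l p)

/-- Values of a position vector together with a frame. -/
abbrev FrameSpace : Type := E3 × E3 × E3 × E3

/-- The projection of `FrameSpace` to the first frame vector. -/
def projX : FrameSpace →L[ℝ] E3 :=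
  (ContinuousLinearMap.fst ℝ E3 (E3 × E3)).comp (ContinuousLinearMap.snd ℝ E3 (E3 × E3 × E3))

/-- The projection of `FrameSpace` to the second frame vector. -/
def projY : FrameSpace →L[ℝ] E3 :=
  ((ContinuousLinearMap.fst ℝ E3 E3).comp (ContinuousLinearMap.snd ℝ E3 (E3 × E3))).comp
    (ContinuousLinearMap.snd ℝ E3 (E3 × E3 × E3))

/-- The projection of `FrameSpace` to the third frame vector. -/
def projL : FrameSpace →L[ℝ] E3 :=
  ((ContinuousLinearMap.snd ℝ E3 E3).comp (ContinuousLinearMap.snd ℝ E3 (E3 × E3))).comp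
    (ContinuousLinearMap.snd ℝ E3 (E3 × E3 × E3))

/-- The operator `(x, X, Y, l) ↦ (rX + sY, aY + bl, -aX + dl, -bX - dY)`. -/
def frameOperator (r s a b d : ℝ) : FrameSpace →L[ℝ] FrameSpace :=
  r • projX.prod (0 : FrameSpace →L[ℝ] E3 × E3 × E3)
    + s • projY.prod (0 : FrameSpace →L[ℝ] E3 × E3 × E3)
    + a • (0 : FrameSpace →L[ℝ] E3).prod (projY.prod ((-projX).prod (0 : FrameSpace →L[ℝ] E3)))
    + b • (0 : FrameSpace →L[ℝ] E3).prod (projL.prod ((0 : FrameSpace →L[ℝ] E3).prod (-projX)))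
    + d • (0 : FrameSpace →L[ℝ] E3).prod ((0 : FrameSpace →L[ℝ] E3).prod (projL.prod (-projY)))

theorem frameOperator_apply (r s a b d : ℝ) (y : FrameSpace) :
    frameOperator r s a b d y = (r • y.2.1 + s • y.2.2.1, a • y.2.2.1 + b • y.2.2.2,
      -(a • y.2.1) + d • y.2.2.2, -(b • y.2.1) - d • y.2.2.1) := by
  simp [frameOperator, projX, projY, projL, sub_eq_add_neg]

theorem contDiffOn_frameOperator {r s a b d : ℝ × ℝ → ℝ} {D : Set (ℝ × ℝ)}
    (hr : ContDiffOn ℝ ∞ r D) (hs : ContDiffOn ℝ ∞ s D) (ha : ContDiffOn ℝ ∞ a D)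
    (hb : ContDiffOn ℝ ∞ b D) (hd : ContDiffOn ℝ ∞ d D) :
    ContDiffOn ℝ ∞ (fun p => frameOperator (r p) (s p) (a p) (b p) (d p)) D :=
  ((((hr.smul contDiffOn_const).add (hs.smul contDiffOn_const)).add
    (ha.smul contDiffOn_const)).add (hb.smul contDiffOn_const)).add (hd.smul contDiffOn_const)

theorem fderiv_frameOperator_apply {r s a b d : ℝ × ℝ → ℝ} {p : ℝ × ℝ}
    (hr : DifferentiableAt ℝ r p) (hs : DifferentiableAt ℝ s p) (ha : DifferentiableAt ℝ a p)
    (hb : DifferentiableAt ℝ b p) (hd : DifferentiableAt ℝ d p) (h : ℝ × ℝ) :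
    fderiv ℝ (fun p => frameOperator (r p) (s p) (a p) (b p) (d p)) p h =
      frameOperator (fderiv ℝ r p h) (fderiv ℝ s p h) (fderiv ℝ a p h) (fderiv ℝ b p h)
        (fderiv ℝ d p h) := by
  have e : ∀ {t : ℝ × ℝ → ℝ}, DifferentiableAt ℝ t p → ∀ T : FrameSpace →L[ℝ] FrameSpace,
      HasFDerivAt (fun p => t p • T) ((fderiv ℝ t p).smulRight T) p :=
    fun ht T => ht.hasFDerivAt.smul_const T
  have h1 : HasFDerivAt (fun p => frameOperator (r p) (s p) (a p) (b p) (d p)) _ p :=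
    ((((e hr _).add (e hs _)).add (e ha _)).add (e hb _)).add (e hd _)
  rw [h1.fderiv]
  rfl

/-- **Fundamental theorem of surface theory** in principal parameters, existence part: the
Gauss and Codazzi equations are sufficient. -/
theorem exists_isFramedSurface {s₁ s₂ a b c d : ℝ × ℝ → ℝ} {D : Set (ℝ × ℝ)} (hD : IsOpen D)
    {p₀ : ℝ × ℝ} (hp₀ : p₀ ∈ D) (hs₁ : ContDiffOn ℝ ∞ s₁ D) (hs₂ : ContDiffOn ℝ ∞ s₂ D)
    (ha : ContDiffOn ℝ ∞ a D) (hb : ContDiffOn ℝ ∞ b D) (hc : ContDiffOn ℝ ∞ c D)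
    (hd : ContDiffOn ℝ ∞ d D)
    (h₁ : ∀ p ∈ D, dv s₁ p = -(s₂ p * a p)) (h₂ : ∀ p ∈ D, du s₂ p = s₁ p * c p)
    (hgauss : ∀ p ∈ D, dv a p - du c p = b p * d p)
    (hcod₁ : ∀ p ∈ D, dv b p = -(a p * d p)) (hcod₂ : ∀ p ∈ D, du d p = c p * b p)
    (x₀ X₀ Y₀ l₀ : E3) (hframe : IsRightFrame X₀ Y₀ l₀) :
    ∃ R > 0, ball p₀ R ⊆ D ∧ ∃ x X Y l : ℝ × ℝ → E3, x p₀ = x₀ ∧ X p₀ = X₀ ∧ Y p₀ = Y₀ ∧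
      l p₀ = l₀ ∧ ContDiffOn ℝ ∞ x (ball p₀ R) ∧
      IsFramedSurface s₁ s₂ a b c d x X Y l (ball p₀ R) := by
  have hzero : ContDiffOn ℝ ∞ (fun _ : ℝ × ℝ => (0 : ℝ)) D := contDiffOn_const
  have hAs := contDiffOn_frameOperator hs₁ hzero ha hb hzero
  have hBs := contDiffOn_frameOperator hzero hs₂ hc hzero hd
  have hdiff : ∀ {r : ℝ × ℝ → ℝ}, ContDiffOn ℝ ∞ r D → ∀ p ∈ D, DifferentiableAt ℝ r p :=
    fun hr p hp => (hr.contDiffAt (hD.mem_nhds hp)).differentiableAt (by simp)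
  -- Equality of mixed derivatives splits by component: `h₁` and `h₂` settle the position vector;
  -- `hgauss`, `hcod₁` and `hcod₂` settle the frame.
  obtain ⟨R, hR, hsub, f, hf0, hfs, hf⟩ := exists_hasFDerivAt_operatorForm hD hp₀ hAs hBs (by
    intro p hp
    have eA := fderiv_frameOperator_apply (hdiff hs₁ p hp) (hdiff hzero p hp) (hdiff ha p hp)
      (hdiff hb p hp) (hdiff hzero p hp) (0, 1)
    have eB := fderiv_frameOperator_apply (hdiff hzero p hp) (hdiff hs₂ p hp) (hdiff hc p hp)
      (hdiff hzero p hp) (hdiff hd p hp) (1, 0)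
    simp only [fderiv_fun_const, Pi.zero_apply, zero_apply] at eA eB
    have ea : dv a p = du c p + b p * d p := by rw [← hgauss p hp]; ring
    change fderiv ℝ _ p (0, 1) + _ = fderiv ℝ _ p (1, 0) + _
    rw [eA, eB]
    change frameOperator (dv s₁ p) 0 (dv a p) (dv b p) 0 + _ =
      frameOperator 0 (du s₂ p) (du c p) 0 (du d p) + _
    rw [h₁ p hp, h₂ p hp, ea, hcod₁ p hp, hcod₂ p hp]
    refine ContinuousLinearMap.ext fun y => ?_
    simp only [add_apply, ContinuousLinearMap.comp_apply, frameOperator_apply, Prod.mk_add_mk,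
      Prod.mk.injEq]
    refine ⟨?_, ?_, ?_, ?_⟩ <;> module) ((x₀, X₀, Y₀, l₀) : FrameSpace)
  have hmov : IsMovingFrame (fun p => coordForm (a p) (c p)) (fun p => coordForm (b p) 0)
      (fun p => coordForm 0 (d p)) (fun p => (f p).2.1) (fun p => (f p).2.2.1)
      (fun p => (f p).2.2.2) (ball p₀ R) := by
    refine ⟨fun p hp => ?_, fun p hp => ?_, fun p hp => ?_⟩
    · refine (hf p hp).snd.fst.congr_fderiv (ContinuousLinearMap.ext fun h => ?_)
      simp [operatorForm_apply, frameOperator_apply]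
      module
    · refine (hf p hp).snd.snd.fst.congr_fderiv (ContinuousLinearMap.ext fun h => ?_)
      simp [operatorForm_apply, frameOperator_apply]
      module
    · refine (hf p hp).snd.snd.snd.congr_fderiv (ContinuousLinearMap.ext fun h => ?_)
      simp [operatorForm_apply, frameOperator_apply]
      module
  refine ⟨R, hR, hsub, fun p => (f p).1, fun p => (f p).2.1, fun p => (f p).2.2.1,
    fun p => (f p).2.2.2, by simp only [hf0], by simp only [hf0], by simp only [hf0],
    by simp only [hf0], hfs.fst, ?_, hmov, ?_⟩
  · intro p hp
    refine (hf p hp).fst.congr_fderiv (ContinuousLinearMap.ext fun h => ?_)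
    simp [operatorForm_apply, frameOperator_apply]
    module
  · intro p hp
    refine hmov.isRightFrame isOpen_ball (convex_ball p₀ R).isPreconnected (mem_ball_self hR) ?_ hp
    simpa only [hf0] using hframe

theorem IsFramedSurface.congr {s₁ s₂ a b c d s₁' s₂' a' b' c' d' : ℝ × ℝ → ℝ}
    {x X Y l : ℝ × ℝ → E3} {D : Set (ℝ × ℝ)} (h : IsFramedSurface s₁ s₂ a b c d x X Y l D)
    (hs₁ : EqOn s₁ s₁' D) (hs₂ : EqOn s₂ s₂' D) (ha : EqOn a a' D) (hb : EqOn b b' D)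
    (hc : EqOn c c' D) (hd : EqOn d d' D) : IsFramedSurface s₁' s₂' a' b' c' d' x X Y l D := by
  refine ⟨fun p hp => ?_, ⟨fun p hp => ?_, fun p hp => ?_, fun p hp => ?_⟩, h.right⟩
  · simpa only [hs₁ hp, hs₂ hp] using h.hasFDerivAt p hp
  · simpa only [ha hp, hb hp, hc hp, hd hp] using h.frame.1 p hp
  · simpa only [ha hp, hb hp, hc hp, hd hp] using h.frame.2 p hp
  · simpa only [ha hp, hb hp, hc hp, hd hp] using h.frame.3 p hp

/-- **Fundamental theorem of surface theory** in principal parameters, uniqueness part. -/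
theorem IsFramedSurface.eqOn {s₁ s₂ a b c d : ℝ × ℝ → ℝ} {x X Y l x' X' Y' l' : ℝ × ℝ → E3}
    {D : Set (ℝ × ℝ)} (h : IsFramedSurface s₁ s₂ a b c d x X Y l D)
    (h' : IsFramedSurface s₁ s₂ a b c d x' X' Y' l' D) (hD : IsOpen D) (hD' : IsPreconnected D)
    {p₀ : ℝ × ℝ} (hp₀ : p₀ ∈ D) (hx : x p₀ = x' p₀) (hX : X p₀ = X' p₀) (hY : Y p₀ = Y' p₀)
    (hl : l p₀ = l' p₀) : EqOn x x' D := by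
  refine hD.eqOn_of_fderiv_eq hD'
    (fun p hp => (h.hasFDerivAt p hp).differentiableAt.differentiableWithinAt)
    (fun p hp => (h'.hasFDerivAt p hp).differentiableAt.differentiableWithinAt)
    (fun p hp => ?_) hp₀ hx
  obtain ⟨h1, h2, -⟩ := (h.frame.sub h'.frame).eq_zero hD hD' hp₀ (sub_eq_zero.2 hX)
    (sub_eq_zero.2 hY) (sub_eq_zero.2 hl) hp
  rw [(h.hasFDerivAt p hp).fderiv, (h'.hasFDerivAt p hp).fderiv, sub_eq_zero.1 h1,
    sub_eq_zero.1 h2]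

end FramedSurface

/-! ### Fundamental forms and curvatures read off from the derivation equations. -/

section Invariants

variable {s₁ s₂ a b c d : ℝ × ℝ → ℝ} {x X Y l : ℝ × ℝ → E3} {D : Set (ℝ × ℝ)} {p : ℝ × ℝ}

theorem IsFramedSurface.du_eq (h : IsFramedSurface s₁ s₂ a b c d x X Y l D) (hp : p ∈ D) :
    du x p = s₁ p • X p := by
  rw [du, (h.hasFDerivAt p hp).fderiv]
  simp

theorem IsFramedSurface.dv_eq (h : IsFramedSurface s₁ s₂ a b c d x X Y l D) (hp : p ∈ D) :
    dv x p = s₂ p • Y p := by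
  rw [dv, (h.hasFDerivAt p hp).fderiv]
  simp

theorem IsFramedSurface.hasFDerivAt_du (h : IsFramedSurface s₁ s₂ a b c d x X Y l D)
    (hD : IsOpen D) (hp : p ∈ D) (hs : DifferentiableAt ℝ s₁ p) :
    HasFDerivAt (du x) (s₁ p • ((coordForm (a p) (c p)).smulRight (Y p) +
      (coordForm (b p) 0).smulRight (l p)) + (fderiv ℝ s₁ p).smulRight (X p)) p :=
  (hs.hasFDerivAt.smul (h.frame.1 p hp)).congr_of_eventuallyEq
    (eventually_of_mem (hD.mem_nhds hp) fun _ hq => h.du_eq hq)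

theorem IsFramedSurface.hasFDerivAt_dv (h : IsFramedSurface s₁ s₂ a b c d x X Y l D)
    (hD : IsOpen D) (hp : p ∈ D) (hs : DifferentiableAt ℝ s₂ p) :
    HasFDerivAt (dv x) (s₂ p • (-(coordForm (a p) (c p)).smulRight (X p) +
      (coordForm 0 (d p)).smulRight (l p)) + (fderiv ℝ s₂ p).smulRight (Y p)) p :=
  (hs.hasFDerivAt.smul (h.frame.2 p hp)).congr_of_eventuallyEq
    (eventually_of_mem (hD.mem_nhds hp) fun _ hq => h.dv_eq hq)

theorem IsFramedSurface.du_du_eq (h : IsFramedSurface s₁ s₂ a b c d x X Y l D)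
    (hD : IsOpen D) (hp : p ∈ D) (hs : DifferentiableAt ℝ s₁ p) :
    du (du x) p = du s₁ p • X p + s₁ p • (a p • Y p + b p • l p) := by
  rw [du, (h.hasFDerivAt_du hD hp hs).fderiv]
  simp [du]
  module

theorem IsFramedSurface.dv_du_eq (h : IsFramedSurface s₁ s₂ a b c d x X Y l D)
    (hD : IsOpen D) (hp : p ∈ D) (hs : DifferentiableAt ℝ s₁ p) :
    dv (du x) p = dv s₁ p • X p + s₁ p • c p • Y p := by
  rw [dv, (h.hasFDerivAt_du hD hp hs).fderiv]
  simp [dv]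
  module

theorem IsFramedSurface.dv_dv_eq (h : IsFramedSurface s₁ s₂ a b c d x X Y l D)
    (hD : IsOpen D) (hp : p ∈ D) (hs : DifferentiableAt ℝ s₂ p) :
    dv (dv x) p = dv s₂ p • Y p + s₂ p • (-(c p • X p) + d p • l p) := by
  rw [dv, (h.hasFDerivAt_dv hD hp hs).fderiv]
  simp [dv]
  module

theorem IsFramedSurface.fE_eq (h : IsFramedSurface s₁ s₂ a b c d x X Y l D) (hp : p ∈ D) :
    fE x p = s₁ p ^ 2 := by
  obtain ⟨hX, -⟩ := orthonormal_triple_iff.1 (h.right p hp).1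
  rw [fE, h.du_eq hp, real_inner_smul_left, real_inner_smul_right, hX]
  ring

theorem IsFramedSurface.fF_eq (h : IsFramedSurface s₁ s₂ a b c d x X Y l D) (hp : p ∈ D) :
    fF x p = 0 := by
  obtain ⟨-, -, -, hXY, -⟩ := orthonormal_triple_iff.1 (h.right p hp).1
  rw [fF, h.du_eq hp, h.dv_eq hp, real_inner_smul_left, real_inner_smul_right, hXY]
  ring

theorem IsFramedSurface.fG_eq (h : IsFramedSurface s₁ s₂ a b c d x X Y l D) (hp : p ∈ D) :
    fG x p = s₂ p ^ 2 := by
  obtain ⟨-, hY, -⟩ := orthonormal_triple_iff.1 (h.right p hp).1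
  rw [fG, h.dv_eq hp, real_inner_smul_left, real_inner_smul_right, hY]
  ring

theorem IsFramedSurface.frameX_eq (h : IsFramedSurface s₁ s₂ a b c d x X Y l D) (hp : p ∈ D)
    (hs₁ : 0 < s₁ p) : frameX x p = X p := by
  rw [frameX, h.fE_eq hp, Real.sqrt_sq hs₁.le, h.du_eq hp, inv_smul_smul₀ hs₁.ne']

theorem IsFramedSurface.frameY_eq (h : IsFramedSurface s₁ s₂ a b c d x X Y l D) (hp : p ∈ D)
    (hs₂ : 0 < s₂ p) : frameY x p = Y p := by
  rw [frameY, h.fG_eq hp, Real.sqrt_sq hs₂.le, h.dv_eq hp, inv_smul_smul₀ hs₂.ne']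

/-- Stated at one point and without derivation equations, because it also serves to identify the
normal while those equations are being derived. -/
theorem normal_eq_of_isRightFrame {r s : ℝ} {X Y l : E3} (hr : 0 < r) (hs : 0 < s)
    (hu : du x p = r • X) (hv : dv x p = s • Y) (h : IsRightFrame X Y l) : normal x p = l := by
  have hl : ‖l‖ = 1 := h.1.1 2
  have hrs : 0 < r * s := mul_pos hr hs
  rw [normal, hu, hv, cross_smul_smul, h.cross_eq, norm_smul, hl, Real.norm_of_nonneg hrs.le,
    mul_one, inv_smul_smul₀ hrs.ne']

theorem IsFramedSurface.normal_eq (h : IsFramedSurface s₁ s₂ a b c d x X Y l D) (hp : p ∈ D)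
    (hs₁ : 0 < s₁ p) (hs₂ : 0 < s₂ p) : normal x p = l p :=
  normal_eq_of_isRightFrame hs₁ hs₂ (h.du_eq hp) (h.dv_eq hp) (h.right p hp)

theorem IsFramedSurface.sL_eq (h : IsFramedSurface s₁ s₂ a b c d x X Y l D)
    (hD : IsOpen D) (hp : p ∈ D) (hs : DifferentiableAt ℝ s₁ p) (hs₁ : 0 < s₁ p)
    (hs₂ : 0 < s₂ p) : sL x p = s₁ p * b p := by
  obtain ⟨-, -, hl, -, hXl, hYl⟩ := orthonormal_triple_iff.1 (h.right p hp).1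
  rw [sL, h.du_du_eq hD hp hs, h.normal_eq hp hs₁ hs₂]
  simp only [inner_add_left, real_inner_smul_left, hl, hXl, hYl]
  ring

theorem IsFramedSurface.sM_eq (h : IsFramedSurface s₁ s₂ a b c d x X Y l D)
    (hD : IsOpen D) (hp : p ∈ D) (hs : DifferentiableAt ℝ s₁ p) (hs₁ : 0 < s₁ p)
    (hs₂ : 0 < s₂ p) : sM x p = 0 := by
  obtain ⟨-, -, -, -, hXl, hYl⟩ := orthonormal_triple_iff.1 (h.right p hp).1
  rw [sM, h.dv_du_eq hD hp hs, h.normal_eq hp hs₁ hs₂]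
  simp only [inner_add_left, real_inner_smul_left, hXl, hYl]
  ring

theorem IsFramedSurface.sN_eq (h : IsFramedSurface s₁ s₂ a b c d x X Y l D)
    (hD : IsOpen D) (hp : p ∈ D) (hs : DifferentiableAt ℝ s₂ p) (hs₁ : 0 < s₁ p)
    (hs₂ : 0 < s₂ p) : sN x p = s₂ p * d p := by
  obtain ⟨-, -, hl, -, hXl, hYl⟩ := orthonormal_triple_iff.1 (h.right p hp).1
  rw [sN, h.dv_dv_eq hD hp hs, h.normal_eq hp hs₁ hs₂]
  simp only [inner_add_left, inner_neg_left, real_inner_smul_left, hl, hXl, hYl]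
  ring

theorem IsFramedSurface.nu1_eq (h : IsFramedSurface s₁ s₂ a b c d x X Y l D)
    (hD : IsOpen D) (hp : p ∈ D) (hs : DifferentiableAt ℝ s₁ p) (hs₁ : 0 < s₁ p)
    (hs₂ : 0 < s₂ p) : nu1 x p = b p / s₁ p := by
  rw [nu1, h.sL_eq hD hp hs hs₁ hs₂, h.fE_eq hp]
  field_simp

theorem IsFramedSurface.nu2_eq (h : IsFramedSurface s₁ s₂ a b c d x X Y l D)
    (hD : IsOpen D) (hp : p ∈ D) (hs : DifferentiableAt ℝ s₂ p) (hs₁ : 0 < s₁ p)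
    (hs₂ : 0 < s₂ p) : nu2 x p = d p / s₂ p := by
  rw [nu2, h.sN_eq hD hp hs hs₁ hs₂, h.fG_eq hp]
  field_simp

theorem IsFramedSurface.gaussCurvature_eq (h : IsFramedSurface s₁ s₂ a b c d x X Y l D)
    (hD : IsOpen D) (hp : p ∈ D) (hds₁ : DifferentiableAt ℝ s₁ p)
    (hds₂ : DifferentiableAt ℝ s₂ p) (hs₁ : 0 < s₁ p) (hs₂ : 0 < s₂ p) :
    gaussCurvature x p = b p / s₁ p * (d p / s₂ p) := by
  rw [gaussCurvature, h.sL_eq hD hp hds₁ hs₁ hs₂, h.sM_eq hD hp hds₁ hs₁ hs₂,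
    h.sN_eq hD hp hds₂ hs₁ hs₂, h.fE_eq hp, h.fF_eq hp, h.fG_eq hp, zero_pow two_ne_zero,
    sub_zero, sub_zero]
  field_simp

theorem IsFramedSurface.gamma1_eq (h : IsFramedSurface s₁ s₂ a b c d x X Y l D)
    (hD : IsOpen D) (hp : p ∈ D) (hs : DifferentiableAt ℝ s₁ p) (hs₁ : 0 < s₁ p)
    (hs₂ : 0 < s₂ p) : gamma1 x p = a p / s₁ p := by
  obtain ⟨hX, hY, -, hXY, -, hYl⟩ := orthonormal_triple_iff.1 (h.right p hp).1
  have hn : ‖X p‖ = 1 := (h.right p hp).1.1 0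
  rw [gamma1, h.du_du_eq hD hp hs, h.normal_eq hp hs₁ hs₂, h.du_eq hp, cross_smul_right,
    (h.right p hp).cyclic.cyclic.cross_eq, norm_smul, hn, Real.norm_of_nonneg hs₁.le]
  simp only [inner_add_left, real_inner_smul_left, real_inner_smul_right, hY, hXY,
    real_inner_comm (Y p) (l p), hYl]
  field_simp
  ring

theorem IsFramedSurface.gamma2_eq (h : IsFramedSurface s₁ s₂ a b c d x X Y l D)
    (hD : IsOpen D) (hp : p ∈ D) (hs : DifferentiableAt ℝ s₂ p) (hs₁ : 0 < s₁ p)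
    (hs₂ : 0 < s₂ p) : gamma2 x p = c p / s₂ p := by
  obtain ⟨hX, hY, -, hXY, hXl, hYl⟩ := orthonormal_triple_iff.1 (h.right p hp).1
  have hn : ‖Y p‖ = 1 := (h.right p hp).1.1 1
  rw [gamma2, h.dv_dv_eq hD hp hs, h.normal_eq hp hs₁ hs₂, h.dv_eq hp, cross_smul_right,
    cross_anticomm, (h.right p hp).cyclic.cross_eq, norm_smul, hn, Real.norm_of_nonneg hs₂.le]
  simp only [inner_add_left, inner_neg_left, inner_neg_right, real_inner_smul_left,
    real_inner_smul_right, hX, real_inner_comm (X p) (Y p), hXY, real_inner_comm (X p) (l p), hXl]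
  field_simp
  ring

/-- A smooth surface with a moving frame along principal lines is regular, in principal
parameters. -/
theorem IsFramedSurface.isSurface (h : IsFramedSurface s₁ s₂ a b c d x X Y l D)
    (hD : IsOpen D) (hD' : IsConnected D) (hx : ContDiffOn ℝ ∞ x D)
    (hs₁ : ∀ p ∈ D, 0 < s₁ p) (hs₂ : ∀ p ∈ D, 0 < s₂ p) : IsSurface x D := by
  refine ⟨hD, hD', hx, fun p hp => ?_⟩
  obtain ⟨hX, hY, -, hXY, -⟩ := orthonormal_triple_iff.1 (h.right p hp).1
  rw [h.du_eq hp, h.dv_eq hp, LinearIndependent.pair_iff]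
  intro r s hrs
  have e1 := congrArg (fun v => (inner ℝ v (X p) : ℝ)) hrs
  have e2 := congrArg (fun v => (inner ℝ v (Y p) : ℝ)) hrs
  simp only [inner_add_left, real_inner_smul_left, inner_zero_left, hX, hY, hXY,
    real_inner_comm (X p) (Y p)] at e1 e2
  simpa [(hs₁ p hp).ne', (hs₂ p hp).ne'] using And.intro e1 e2

end Invariants

/-! ### Gauss and Weingarten equations of a given surface. -/

section DerivationEquations

/-- Differentiated constancy of an inner product; for the frame fields it is the skewness of the
connection matrix. -/
theorem inner_fderiv_add_inner_fderiv_eq_zero {X Y : ℝ × ℝ → E3} {D : Set (ℝ × ℝ)} {k : ℝ}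
    (hD : IsOpen D) (hXY : ∀ p ∈ D, inner ℝ (X p) (Y p) = k) {p : ℝ × ℝ} (hp : p ∈ D)
    (hX : DifferentiableAt ℝ X p) (hY : DifferentiableAt ℝ Y p) (h : ℝ × ℝ) :
    inner ℝ (X p) (fderiv ℝ Y p h) + inner ℝ (fderiv ℝ X p h) (Y p) = 0 := by
  rw [← fderiv_inner_apply ℝ hX hY]
  have : (fun q => (inner ℝ (X q) (Y q) : ℝ)) =ᶠ[𝓝 p] fun _ => k :=
    eventually_of_mem (hD.mem_nhds hp) hXY
  rw [this.fderiv_eq]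
  simp

theorem du_dv_eq_dv_du {x : ℝ × ℝ → E3} {D : Set (ℝ × ℝ)} (hD : IsOpen D)
    (hx : ContDiffOn ℝ ∞ x D) {p : ℝ × ℝ} (hp : p ∈ D) : du (dv x) p = dv (du x) p := by
  have hxp : ContDiffAt ℝ ∞ x p := hx.contDiffAt (hD.mem_nhds hp)
  have hsymm : IsSymmSndFDerivAt ℝ x p := 
    (contDiffAt_infty.1 hxp 2).isSymmSndFDerivAt (by simp)
  have hd : DifferentiableAt ℝ (fderiv ℝ x) p :=
    ((contDiffAt_infty.1 hxp 2).fderiv_right (m := 1) (by norm_num)).differentiableAt (by simp)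
  have e : ∀ w : ℝ × ℝ, fderiv ℝ (fun q => fderiv ℝ x q w) p =
      (fderiv ℝ (fderiv ℝ x) p).flip w := fun w => by
    rw [fderiv_clm_apply hd (differentiableAt_const w)]
    simp
  change fderiv ℝ (fun q => fderiv ℝ x q (0, 1)) p (1, 0) =
    fderiv ℝ (fun q => fderiv ℝ x q (1, 0)) p (0, 1)
  rw [e, e]
  exact hsymm.eq (1, 0) (0, 1)

theorem contDiffOn_fderiv_apply {V : Type*} [NormedAddCommGroup V] [NormedSpace ℝ V]
    {f : ℝ × ℝ → V} {D : Set (ℝ × ℝ)} (hD : IsOpen D)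
    (hf : ContDiffOn ℝ ∞ f D) (w : ℝ × ℝ) : ContDiffOn ℝ ∞ (fun p => fderiv ℝ f p w) D :=
  (hf.fderiv_of_isOpen hD (by simp)).clm_apply contDiffOn_const

/-- The derivation equations of Gauss and Weingarten in principal parameters. -/
theorem isFramedSurface_of_isPrincipalNet {x : ℝ × ℝ → E3} {D : Set (ℝ × ℝ)}
    (hx : IsSurface x D) (hnet : IsPrincipalNet x D) :
    IsFramedSurface (fun p => √(fE x p)) (fun p => √(fG x p)) (fun p => √(fE x p) * gamma1 x p)
      (fun p => √(fE x p) * nu1 x p) (fun p => √(fG x p) * gamma2 x p)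
      (fun p => √(fG x p) * nu2 x p) x (frameX x) (frameY x) (normal x) D := by
  have hD := hx.isOpen
  have hdu : ContDiffOn ℝ ∞ (du x) D := contDiffOn_fderiv_apply hD hx.smooth _
  have hdv : ContDiffOn ℝ ∞ (dv x) D := contDiffOn_fderiv_apply hD hx.smooth _
  have hE0 : ∀ p ∈ D, 0 < fE x p := fun p hp => real_inner_self_pos.2 ((hx.regular p hp).ne_zero 0)
  have hG0 : ∀ p ∈ D, 0 < fG x p := fun p hp => real_inner_self_pos.2 ((hx.regular p hp).ne_zero 1)
  have hr₁ : ∀ p ∈ D, 0 < √(fE x p) := fun p hp => Real.sqrt_pos.2 (hE0 p hp)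
  have hr₂ : ∀ p ∈ D, 0 < √(fG x p) := fun p hp => Real.sqrt_pos.2 (hG0 p hp)
  have hsq₁ : ∀ p ∈ D, √(fE x p) ^ 2 = fE x p := fun p hp => Real.sq_sqrt (hE0 p hp).le
  have hsq₂ : ∀ p ∈ D, √(fG x p) ^ 2 = fG x p := fun p hp => Real.sq_sqrt (hG0 p hp).le
  have hds₁ : ContDiffOn ℝ ∞ (fun p => √(fE x p)) D :=
    (hdu.inner ℝ hdu).sqrt fun p hp => (hE0 p hp).ne'
  have hds₂ : ContDiffOn ℝ ∞ (fun p => √(fG x p)) D :=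
    (hdv.inner ℝ hdv).sqrt fun p hp => (hG0 p hp).ne'
  have hXs : ContDiffOn ℝ ∞ (frameX x) D := (hds₁.inv fun p hp => (hr₁ p hp).ne').smul hdu
  have hYs : ContDiffOn ℝ ∞ (frameY x) D := (hds₂.inv fun p hp => (hr₂ p hp).ne').smul hdv
  have hdiff : ∀ {W : Type} [NormedAddCommGroup W] [NormedSpace ℝ W] {f : ℝ × ℝ → W},
      ContDiffOn ℝ ∞ f D → ∀ p ∈ D, DifferentiableAt ℝ f p := fun hf p hp =>
    (hf.contDiffAt (hD.mem_nhds hp)).differentiableAt (by simp)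
  have hu : ∀ p ∈ D, du x p = √(fE x p) • frameX x p := fun p hp => by
    rw [frameX, smul_inv_smul₀ (hr₁ p hp).ne']
  have hv : ∀ p ∈ D, dv x p = √(fG x p) • frameY x p := fun p hp => by
    rw [frameY, smul_inv_smul₀ (hr₂ p hp).ne']
  have hXX : ∀ p ∈ D, inner ℝ (frameX x p) (frameX x p) = (1 : ℝ) := fun p hp => by
    rw [frameX, real_inner_smul_left, real_inner_smul_right]
    change _ * (_ * fE x p) = 1
    rw [← hsq₁ p hp, Real.sqrt_sq (hr₁ p hp).le]
    have := (hr₁ p hp).ne'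
    field_simp
  have hYY : ∀ p ∈ D, inner ℝ (frameY x p) (frameY x p) = (1 : ℝ) := fun p hp => by
    rw [frameY, real_inner_smul_left, real_inner_smul_right]
    change _ * (_ * fG x p) = 1
    rw [← hsq₂ p hp, Real.sqrt_sq (hr₂ p hp).le]
    have := (hr₂ p hp).ne'
    field_simp
  have hXY : ∀ p ∈ D, inner ℝ (frameX x p) (frameY x p) = (0 : ℝ) := fun p hp => by
    rw [frameX, frameY, real_inner_smul_left, real_inner_smul_right]
    change _ * (_ * fF x p) = 0
    rw [(hnet p hp).1, mul_zero, mul_zero]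
  have hright' : ∀ p ∈ D,
      IsRightFrame (frameX x p) (frameY x p) (cross (frameX x p) (frameY x p)) := fun p hp => by
    have hc : (inner ℝ (cross (frameX x p) (frameY x p)) (cross (frameX x p) (frameY x p)) : ℝ)
        = 1 := by
      rw [inner_cross_cross, hXX p hp, hYY p hp, hXY p hp]
      norm_num
    refine ⟨orthonormal_triple_iff.2 ⟨hXX p hp, hYY p hp, hc, hXY p hp, ?_, ?_⟩, ?_⟩
    · rw [real_inner_comm, inner_cross_left_self]
    · rw [real_inner_comm, inner_cross_right_self]
    · rw [det_eq_inner_cross, hc]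
      exact one_pos
  have hnormal : ∀ p ∈ D, normal x p = cross (frameX x p) (frameY x p) := fun p hp =>
    normal_eq_of_isRightFrame (hr₁ p hp) (hr₂ p hp) (hu p hp) (hv p hp) (hright' p hp)
  have hright : ∀ p ∈ D, IsRightFrame (frameX x p) (frameY x p) (normal x p) := fun p hp => by
    rw [hnormal p hp]
    exact hright' p hp
  have hddu : ∀ p ∈ D, ∀ h : ℝ × ℝ, fderiv ℝ (du x) p h =
      √(fE x p) • fderiv ℝ (frameX x) p h + fderiv ℝ (fun q => √(fE x q)) p h • frameX x p := by
    intro p hp h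
    have := ((hdiff hds₁ p hp).hasFDerivAt.smul
      (hdiff hXs p hp).hasFDerivAt).congr_of_eventuallyEq
      (eventually_of_mem (hD.mem_nhds hp) fun q hq => hu q hq)
    rw [this.fderiv]
    simp
  have hddv : ∀ p ∈ D, ∀ h : ℝ × ℝ, fderiv ℝ (dv x) p h =
      √(fG x p) • fderiv ℝ (frameY x) p h + fderiv ℝ (fun q => √(fG x q)) p h • frameY x p := by
    intro p hp h
    have := ((hdiff hds₂ p hp).hasFDerivAt.smul
      (hdiff hYs p hp).hasFDerivAt).congr_of_eventuallyEq
      (eventually_of_mem (hD.mem_nhds hp) fun q hq => hv q hq)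
    rw [this.fderiv]
    simp
  have hframe : ∀ p ∈ D,
      du (frameX x) p = (√(fE x p) * gamma1 x p) • frameY x p
        + (√(fE x p) * nu1 x p) • normal x p ∧
      dv (frameX x) p = (√(fG x p) * gamma2 x p) • frameY x p ∧
      du (frameY x) p = -((√(fE x p) * gamma1 x p) • frameX x p) ∧
      dv (frameY x) p = -((√(fG x p) * gamma2 x p) • frameX x p)
        + (√(fG x p) * nu2 x p) • normal x p := by
    intro p hp
    have hf := hright p hp
    obtain ⟨eXX, eYY, ell, eXY, eXl, eYl⟩ := orthonormal_triple_iff.1 hf.1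
    have hXh := inner_fderiv_add_inner_fderiv_eq_zero hD hXX hp (hdiff hXs p hp) (hdiff hXs p hp)
    have hYh := inner_fderiv_add_inner_fderiv_eq_zero hD hYY hp (hdiff hYs p hp) (hdiff hYs p hp)
    have hXYh := inner_fderiv_add_inner_fderiv_eq_zero hD hXY hp (hdiff hXs p hp) (hdiff hYs p hp)
    have r₁ := hr₁ p hp
    have r₂ := hr₂ p hp
    have nX : ‖frameX x p‖ = 1 := hf.1.1 0
    have nY : ‖frameY x p‖ = 1 := hf.1.1 1
    have hXXh : ∀ h, inner ℝ (fderiv ℝ (frameX x) p h) (frameX x p) = (0 : ℝ) := fun h => by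
      have := hXh h
      rw [real_inner_comm] at this
      linarith
    have hYYh : ∀ h, inner ℝ (fderiv ℝ (frameY x) p h) (frameY x p) = (0 : ℝ) := fun h => by
      have := hYh h
      rw [real_inner_comm] at this
      linarith
    have hYXh : ∀ h, inner ℝ (fderiv ℝ (frameY x) p h) (frameX x p) =
        -(inner ℝ (fderiv ℝ (frameX x) p h) (frameY x p) : ℝ) := fun h => by
      have := hXYh h
      rw [real_inner_comm] at this
      linarith
    have g1 : gamma1 x p = inner ℝ (du (frameX x) p) (frameY x p) / √(fE x p) := by
      rw [gamma1, hu p hp, cross_smul_right, hf.cyclic.cyclic.cross_eq, norm_smul, nX,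
        Real.norm_of_nonneg r₁.le, du, hddu p hp]
      simp only [inner_add_left, real_inner_smul_left, real_inner_smul_right, eXY, du]
      field_simp
      ring
    have g2 : gamma2 x p = -inner ℝ (dv (frameY x) p) (frameX x p) / √(fG x p) := by
      rw [gamma2, hv p hp, cross_smul_right, cross_anticomm, hf.cyclic.cross_eq, norm_smul, nY,
        Real.norm_of_nonneg r₂.le, dv, hddv p hp]
      simp only [inner_add_left, real_inner_smul_left, real_inner_smul_right, inner_neg_right,
        real_inner_comm (frameX x p) (frameY x p), eXY, dv]
      field_simp
      ring
    have n1 : nu1 x p = inner ℝ (du (frameX x) p) (normal x p) / √(fE x p) := by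
      rw [nu1, sL, du, hddu p hp, ← hsq₁ p hp, Real.sqrt_sq r₁.le]
      simp only [inner_add_left, real_inner_smul_left, eXl, du]
      field_simp
      ring
    have n2 : nu2 x p = inner ℝ (dv (frameY x) p) (normal x p) / √(fG x p) := by
      rw [nu2, sN, dv, hddv p hp, ← hsq₂ p hp, Real.sqrt_sq r₂.le]
      simp only [inner_add_left, real_inner_smul_left, eYl, dv]
      field_simp
      ring
    have m1 : (inner ℝ (dv (frameX x) p) (normal x p) : ℝ) = 0 := by
      have := (hnet p hp).2
      rw [sM, dv, hddu p hp] at this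
      simp only [inner_add_left, real_inner_smul_left, eXl, mul_zero, add_zero] at this
      exact (mul_eq_zero.1 this).resolve_left r₁.ne'
    -- `M` is defined by `x_uv`, but here `x_vu` is needed, so symmetry of second derivatives
    -- enters.
    have m2 : (inner ℝ (du (frameY x) p) (normal x p) : ℝ) = 0 := by
      have := (hnet p hp).2
      rw [sM, ← du_dv_eq_dv_du hD hx.smooth hp, du, hddv p hp] at this
      simp only [inner_add_left, real_inner_smul_left, eYl, mul_zero, add_zero] at this
      exact (mul_eq_zero.1 this).resolve_left r₂.ne'
    have g1' : (inner ℝ (du (frameX x) p) (frameY x p) : ℝ) = √(fE x p) * gamma1 x p := by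
      rw [g1]; field_simp
    have g2' : (inner ℝ (dv (frameY x) p) (frameX x p) : ℝ) = -(√(fG x p) * gamma2 x p) := by
      rw [g2]; field_simp
    have n1' : (inner ℝ (du (frameX x) p) (normal x p) : ℝ) = √(fE x p) * nu1 x p := by
      rw [n1]; field_simp
    have n2' : (inner ℝ (dv (frameY x) p) (normal x p) : ℝ) = √(fG x p) * nu2 x p := by
      rw [n2]; field_simp
    have g1'' : (inner ℝ (du (frameY x) p) (frameX x p) : ℝ) = -(√(fE x p) * gamma1 x p) := by
      rw [← g1']; exact hYXh (1, 0)
    have g2'' : (inner ℝ (dv (frameX x) p) (frameY x p) : ℝ) = √(fG x p) * gamma2 x p := by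
      have : (inner ℝ (dv (frameY x) p) (frameX x p) : ℝ) = _ := hYXh (0, 1)
      rw [g2'] at this
      exact (neg_injective this).symm
    refine ⟨?_, ?_, ?_, ?_⟩
    · rw [eq_sum_inner_smul hf.1 (du (frameX x) p), g1', n1',
        show (inner ℝ (du (frameX x) p) (frameX x p) : ℝ) = 0 from hXXh _, zero_smul, zero_add]
    · rw [eq_sum_inner_smul hf.1 (dv (frameX x) p), g2'', m1,
        show (inner ℝ (dv (frameX x) p) (frameX x p) : ℝ) = 0 from hXXh _, zero_smul, zero_smul,
        zero_add, add_zero]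
    · rw [eq_sum_inner_smul hf.1 (du (frameY x) p), g1'', m2,
        show (inner ℝ (du (frameY x) p) (frameY x p) : ℝ) = 0 from hYYh _, zero_smul, zero_smul,
        add_zero, add_zero, neg_smul]
    · rw [eq_sum_inner_smul hf.1 (dv (frameY x) p), g2', n2',
        show (inner ℝ (dv (frameY x) p) (frameY x p) : ℝ) = 0 from hYYh _, zero_smul, add_zero,
        neg_smul]
  have hXd : ∀ p ∈ D, HasFDerivAt (frameX x)
      ((coordForm (√(fE x p) * gamma1 x p) (√(fG x p) * gamma2 x p)).smulRight (frameY x p)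
        + (coordForm (√(fE x p) * nu1 x p) 0).smulRight (normal x p)) p := fun p hp => by
    refine (hdiff hXs p hp).hasFDerivAt.congr_fderiv (ContinuousLinearMap.ext fun h => ?_)
    rw [fderiv_apply_eq_smul, (hframe p hp).1, (hframe p hp).2.1]
    simp
    module
  have hYd : ∀ p ∈ D, HasFDerivAt (frameY x)
      (-(coordForm (√(fE x p) * gamma1 x p) (√(fG x p) * gamma2 x p)).smulRight (frameX x p)
        + (coordForm 0 (√(fG x p) * nu2 x p)).smulRight (normal x p)) p := fun p hp => by
    refine (hdiff hYs p hp).hasFDerivAt.congr_fderiv (ContinuousLinearMap.ext fun h => ?_)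
    rw [fderiv_apply_eq_smul, (hframe p hp).2.2.1, (hframe p hp).2.2.2]
    simp
    module
  refine ⟨fun p hp => ?_, ⟨hXd, hYd, fun p hp => ?_⟩, hright⟩
  · refine (hdiff hx.smooth p hp).hasFDerivAt.congr_fderiv (ContinuousLinearMap.ext fun h => ?_)
    rw [fderiv_apply_eq_smul, hu p hp, hv p hp]
    simp
    module
  -- The equation for the normal follows from those for `X` and `Y` by differentiating `l = X × Y`.
  · refine ((hasFDerivAt_cross (hXd p hp) (hYd p hp)).congr_of_eventuallyEq
      (eventually_of_mem (hD.mem_nhds hp) hnormal)).congr_fderiv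
      (ContinuousLinearMap.ext fun h => ?_)
    simp [crossL_apply, cross_self]
    rw [cross_anticomm (frameX x p) (normal x p), (hright p hp).cyclic.cyclic.cross_eq,
      cross_anticomm (normal x p) (frameY x p), (hright p hp).cyclic.cross_eq]
    module

end DerivationEquations

/-! ### The canonical coefficients as functions of the first principal curvature. -/

section CanonicalCoefficients

/-- The function `√|t² - K|`. -/
def radical (K t : ℝ) : ℝ := √|t ^ 2 - K|

/-- The coefficient `√E` of a surface in canonical principal parameters. -/
def sqrtE (K t : ℝ) : ℝ := (radical K t)⁻¹

/-- The coefficient `√G` of a surface in canonical principal parameters. -/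
def sqrtG (K t : ℝ) : ℝ := t * radical K t / (t ^ 2 - K)

variable {K t : ℝ}

theorem radical_pos (h : t ^ 2 - K ≠ 0) : 0 < radical K t := Real.sqrt_pos.2 (abs_pos.2 h)

theorem sign_mul_eq_abs (r : ℝ) : Real.sign r * r = |r| := by
  obtain h | rfl | h := lt_trichotomy r 0
  · rw [Real.sign_of_neg h, abs_of_neg h, neg_one_mul]
  · simp
  · rw [Real.sign_of_pos h, abs_of_pos h, one_mul]

theorem sign_sq {r : ℝ} (h : r ≠ 0) : Real.sign r ^ 2 = 1 := by
  obtain h | h := h.lt_or_gt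
  · rw [Real.sign_of_neg h]; norm_num
  · rw [Real.sign_of_pos h]; norm_num

theorem radical_sq (K t : ℝ) : radical K t ^ 2 = Real.sign (t ^ 2 - K) * (t ^ 2 - K) := by
  rw [radical, Real.sq_sqrt (abs_nonneg _), sign_mul_eq_abs]

theorem sqrt_sign_mul (K t : ℝ) : √(Real.sign (t ^ 2 - K) * (t ^ 2 - K)) = radical K t := by
  rw [sign_mul_eq_abs, radical]

theorem sqrtE_pos (h : t ^ 2 - K ≠ 0) : 0 < sqrtE K t := inv_pos.2 (radical_pos h)

/-- The hypothesis says that `t` and `t ^ 2 - K` have the same sign, so the quotient is `|t| /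
radical K t`, written without a sign factor. -/
theorem sqrtG_pos (h : 0 < t * (t ^ 2 - K)) : 0 < sqrtG K t := by
  have hN : t ^ 2 - K ≠ 0 := (mul_ne_zero_iff.1 h.ne').2
  have : sqrtG K t = t * (t ^ 2 - K) * radical K t / (t ^ 2 - K) ^ 2 := by
    rw [sqrtG]
    field_simp
  rw [this]
  have := radical_pos hN
  positivity

theorem sqrtE_sq (h : t ^ 2 - K ≠ 0) :
    sqrtE K t ^ 2 = Real.sign (t ^ 2 - K) / (t ^ 2 - K) := by
  have h1 := sign_sq h
  have h2 : Real.sign (t ^ 2 - K) ≠ 0 := fun h0 => by rw [h0] at h1; norm_num at h1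
  rw [sqrtE, inv_pow, radical_sq, inv_eq_one_div, div_eq_div_iff (mul_ne_zero h2 h) h]
  linear_combination -(t ^ 2 - K) * h1

theorem sqrtG_sq (h : t ^ 2 - K ≠ 0) :
    sqrtG K t ^ 2 = Real.sign (t ^ 2 - K) * t ^ 2 / (t ^ 2 - K) := by
  rw [sqrtG, div_pow, mul_pow, radical_sq]
  field_simp

theorem hasDerivAt_radical (h : t ^ 2 - K ≠ 0) :
    HasDerivAt (radical K) (t * radical K t / (t ^ 2 - K)) t := by
  have h1 : HasDerivAt (fun s : ℝ => s ^ 2 - K) (2 * t) t := by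
    simpa using (hasDerivAt_pow 2 t).sub_const K
  have ha : HasDerivAt (fun s : ℝ => |s ^ 2 - K|) _ t :=
    HasDerivAt.comp (h₂ := fun r : ℝ => |r|) (h := fun s : ℝ => s ^ 2 - K) t (hasDerivAt_abs h) h1
  have h2 := ha.sqrt (abs_pos.2 h).ne'
  refine h2.congr_deriv ?_
  have hw := radical_pos h
  have hsq : radical K t ^ 2 = |t ^ 2 - K| := Real.sq_sqrt (abs_nonneg _)
  have hs : ((SignType.sign (t ^ 2 - K) : SignType) : ℝ) * (t ^ 2 - K) = |t ^ 2 - K| := by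
    rw [mul_comm]; exact self_mul_sign _
  change _ / (2 * radical K t) = _
  rw [div_eq_div_iff (by positivity) h]
  linear_combination 2 * t * hs - 2 * t * hsq

theorem hasDerivAt_sqrtE (h : t ^ 2 - K ≠ 0) :
    HasDerivAt (sqrtE K) (-(t / ((t ^ 2 - K) * radical K t))) t := by
  have hw := (radical_pos h).ne'
  refine ((hasDerivAt_radical h).inv hw).congr_deriv ?_
  field_simp

theorem hasDerivAt_sqrtG (h : t ^ 2 - K ≠ 0) :
    HasDerivAt (sqrtG K) (-(K * radical K t / (t ^ 2 - K) ^ 2)) t := by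
  have h1 : HasDerivAt (fun s : ℝ => s ^ 2 - K) (2 * t) t := by
    simpa using (hasDerivAt_pow 2 t).sub_const K
  refine (((hasDerivAt_id t).mul (hasDerivAt_radical h)).div h1 h).congr_deriv ?_
  simp
  field_simp
  ring

theorem contDiffAt_radical (h : t ^ 2 - K ≠ 0) : ContDiffAt ℝ ∞ (radical K) t :=
  (ContDiffAt.abs (f := fun s => s ^ 2 - K) (by fun_prop) h).sqrt (abs_pos.2 h).ne'

/-- The differentiated function is the coefficient `√E ν₁`; its derivative yields the first Codazzi
equation. -/
theorem hasDerivAt_mul_sqrtE (h : t ^ 2 - K ≠ 0) :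
    HasDerivAt (fun s => s * sqrtE K s) (-(K / ((t ^ 2 - K) * radical K t))) t := by
  have hw := (radical_pos h).ne'
  refine ((hasDerivAt_id t).mul (hasDerivAt_sqrtE h)).congr_deriv ?_
  simp [sqrtE]
  field_simp
  ring

/-- For `s ≠ 0` the differentiated function is the coefficient `√G ν₂`, with the factor `s`
cancelled; its derivative yields the second Codazzi equation. -/
theorem hasDerivAt_mul_radical_div (h : t ^ 2 - K ≠ 0) :
    HasDerivAt (fun s => K * (radical K s / (s ^ 2 - K)))
      (-(K * t * radical K t / (t ^ 2 - K) ^ 2)) t := by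
  have h1 : HasDerivAt (fun s : ℝ => s ^ 2 - K) (2 * t) t := by
    simpa using (hasDerivAt_pow 2 t).sub_const K
  refine (((hasDerivAt_radical h).div h1 h).const_mul K).congr_deriv ?_
  field_simp
  ring

theorem radical_pow_four (h : t ^ 2 - K ≠ 0) : radical K t ^ 4 = (t ^ 2 - K) ^ 2 := by
  rw [show radical K t ^ 4 = (radical K t ^ 2) ^ 2 by ring, radical_sq, mul_pow, sign_sq h,
    one_mul]

end CanonicalCoefficients

/-! ### Integrability of the system built from `ν`. -/

section CanonicalSystem

variable {K : ℝ} {ν : ℝ × ℝ → ℝ} {D : Set (ℝ × ℝ)}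

theorem fderiv_comp_apply_eq_mul {φ : ℝ → ℝ} {φ' : ℝ} {p : ℝ × ℝ} (hφ : HasDerivAt φ φ' (ν p))
    (hν : DifferentiableAt ℝ ν p) (h : ℝ × ℝ) :
    fderiv ℝ (fun q => φ (ν q)) p h = φ' * fderiv ℝ ν p h := by
  have : HasFDerivAt (fun q => φ (ν q)) _ p := hφ.comp_hasFDerivAt p hν.hasFDerivAt
  rw [this.fderiv]
  simp

/-- With `γ₁` and `γ₂` as prescribed, `√E γ₁ = E ν_v` and `√G γ₂ = -K E ν_u`. The Gauss equation
becomes `(E ν_v)_v + K (E ν_u)_u = ε K ν E`, which is the given equation multiplied by `E`; the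
other conditions hold by the chain rule alone. -/
theorem exists_isFramedSurface_of_canonical_equation (hD : IsOpen D) {p₀ : ℝ × ℝ} (hp₀ : p₀ ∈ D)
    (hν : ContDiffOn ℝ ∞ ν D) (hN : ∀ p ∈ D, ν p ^ 2 - K ≠ 0)
    (hpde : ∀ p ∈ D, dv (dv ν) p + K * du (du ν) p
          - 2 * ν p / (ν p ^ 2 - K) * (dv ν p ^ 2 + K * du ν p ^ 2)
        = Real.sign (ν p ^ 2 - K) * K * ν p)
    (x₀ X₀ Y₀ l₀ : E3) (hframe : IsRightFrame X₀ Y₀ l₀) :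
    ∃ R > 0, ball p₀ R ⊆ D ∧ ∃ x X Y l : ℝ × ℝ → E3, x p₀ = x₀ ∧ X p₀ = X₀ ∧ Y p₀ = Y₀ ∧
      l p₀ = l₀ ∧ ContDiffOn ℝ ∞ x (ball p₀ R) ∧
      IsFramedSurface (fun p => sqrtE K (ν p)) (fun p => sqrtG K (ν p))
        (fun p => dv ν p * sqrtE K (ν p) ^ 2) (fun p => ν p * sqrtE K (ν p))
        (fun p => -(K * (du ν p * sqrtE K (ν p) ^ 2)))
        (fun p => K * (radical K (ν p) / (ν p ^ 2 - K))) x X Y l (ball p₀ R) := by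
  have hw : ContDiffOn ℝ ∞ (fun p => radical K (ν p)) D := fun p hp =>
    (contDiffAt_radical (hN p hp)).comp_contDiffWithinAt p (hν p hp)
  have hw0 : ∀ p ∈ D, radical K (ν p) ≠ 0 := fun p hp => (radical_pos (hN p hp)).ne'
  have hNs : ContDiffOn ℝ ∞ (fun p => ν p ^ 2 - K) D := (hν.pow 2).sub contDiffOn_const
  have hu : ContDiffOn ℝ ∞ (du ν) D := contDiffOn_fderiv_apply hD hν _
  have hv : ContDiffOn ℝ ∞ (dv ν) D := contDiffOn_fderiv_apply hD hν _
  have hs₁ : ContDiffOn ℝ ∞ (fun p => sqrtE K (ν p)) D := hw.inv hw0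
  have hs₂ : ContDiffOn ℝ ∞ (fun p => sqrtG K (ν p)) D := (hν.mul hw).div hNs hN
  have hdiff : ∀ {f : ℝ × ℝ → ℝ}, ContDiffOn ℝ ∞ f D → ∀ p ∈ D, DifferentiableAt ℝ f p :=
    fun hf p hp => (hf.contDiffAt (hD.mem_nhds hp)).differentiableAt (by simp)
  -- Product rule for `g * E`: the logarithmic derivative of `E` is `-2ν dν / (ν² - K)`, the source
  -- of the quadratic first order terms in the equation.
  have hρ : ∀ p ∈ D, ∀ h, ∀ {g : ℝ × ℝ → ℝ}, ContDiffOn ℝ ∞ g D →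
      fderiv ℝ (fun q => g q * sqrtE K (ν q) ^ 2) p h = fderiv ℝ g p h / radical K (ν p) ^ 2
        - 2 * ν p / ((ν p ^ 2 - K) * radical K (ν p) ^ 2) * (g p * fderiv ℝ ν p h) := by
    intro p hp h g hg
    have hE := fderiv_comp_apply_eq_mul (hasDerivAt_sqrtE (hN p hp)) (hdiff hν p hp) h
    have h1 : HasFDerivAt (fun q => g q * sqrtE K (ν q) ^ 2) _ p :=
      (hdiff hg p hp).hasFDerivAt.mul ((hdiff hs₁ p hp).hasFDerivAt.pow 2)
    rw [h1.fderiv]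
    simp [hE]
    have := hw0 p hp
    have := hN p hp
    simp only [sqrtE]
    field_simp
    ring
  refine exists_isFramedSurface (d := fun p => K * (radical K (ν p) / (ν p ^ 2 - K)))
    (c := fun p => -(K * (du ν p * sqrtE K (ν p) ^ 2))) hD hp₀ hs₁ hs₂ (hv.mul (hs₁.pow 2)) (hν.mul hs₁)
    (contDiffOn_const.mul (hu.mul (hs₁.pow 2))).neg (contDiffOn_const.mul (hw.div hNs hN))
    ?_ ?_ ?_ ?_ ?_ x₀ X₀ Y₀ l₀ hframe
  · intro p hp
    have h0 := hw0 p hp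
    have h1 := hN p hp
    rw [dv, fderiv_comp_apply_eq_mul (hasDerivAt_sqrtE h1) (hdiff hν p hp)]
    change _ * dv ν p = _
    simp only [sqrtE, sqrtG]
    field_simp
  · intro p hp
    have h0 := hw0 p hp
    have h1 := hN p hp
    rw [du, fderiv_comp_apply_eq_mul (hasDerivAt_sqrtG h1) (hdiff hν p hp)]
    change _ * du ν p = _
    simp only [sqrtE]
    rw [← radical_pow_four h1]
    field_simp
  · intro p hp
    have h0 := hw0 p hp
    have h1 := hN p hp
    have h2 := radical_sq K (ν p)
    have h3 := sign_sq h1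
    have e2 : du (fun q => -(K * (du ν q * sqrtE K (ν q) ^ 2))) p =
        -(K * du (fun q => du ν q * sqrtE K (ν q) ^ 2) p) := by
      have h4 : HasFDerivAt (fun q => -(K * (du ν q * sqrtE K (ν q) ^ 2))) _ p :=
        ((hdiff (hu.mul (hs₁.pow 2)) p hp).hasFDerivAt.const_mul K).neg
      rw [du, h4.fderiv]
      rfl
    have e3 : dv (fun q => dv ν q * sqrtE K (ν q) ^ 2) p = dv (dv ν) p / radical K (ν p) ^ 2
        - 2 * ν p / ((ν p ^ 2 - K) * radical K (ν p) ^ 2) * (dv ν p * dv ν p) := hρ p hp _ hv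
    have e4 : du (fun q => du ν q * sqrtE K (ν q) ^ 2) p = du (du ν) p / radical K (ν p) ^ 2
        - 2 * ν p / ((ν p ^ 2 - K) * radical K (ν p) ^ 2) * (du ν p * du ν p) := hρ p hp _ hu
    have e5 : ν p * sqrtE K (ν p) * (K * (radical K (ν p) / (ν p ^ 2 - K))) =
        Real.sign (ν p ^ 2 - K) * K * ν p / radical K (ν p) ^ 2 := by
      simp only [sqrtE]
      rw [div_eq_mul_inv (_ * K * _), eq_mul_inv_iff_mul_eq₀ (pow_ne_zero 2 h0)]
      rw [h2]
      field_simp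
    rw [e2, e3, e4, e5, ← hpde p hp]
    field_simp
    ring
  · intro p hp
    have h0 := hw0 p hp
    have h1 := hN p hp
    rw [dv, fderiv_comp_apply_eq_mul (hasDerivAt_mul_sqrtE h1) (hdiff hν p hp)]
    change _ * dv ν p = _
    simp only [sqrtE]
    field_simp
  · intro p hp
    have h0 := hw0 p hp
    have h1 := hN p hp
    rw [du, fderiv_comp_apply_eq_mul (hasDerivAt_mul_radical_div h1) (hdiff hν p hp)]
    change _ * du ν p = _
    simp only [sqrtE]
    rw [← radical_pow_four h1]
    field_simp

end CanonicalSystem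

/-! ### Solutions of the problem as framed surfaces. -/

section Solutions

variable {K : ℝ} {ν : ℝ × ℝ → ℝ} {D : Set (ℝ × ℝ)}

/-- Supplies the antiderivative of `f' / (f - g)` for which `√E` times its exponential is exactly
`1`. -/
theorem hasDerivAt_neg_log_sqrtE {t : ℝ} (h : t ^ 2 - K ≠ 0) :
    HasDerivAt (fun s => -Real.log (sqrtE K s)) (deriv (fun s : ℝ => s) t / (t - K / t)) t := by
  have hw := (radical_pos h).ne'
  refine ((hasDerivAt_sqrtE h).log (sqrtE_pos h).ne').neg.congr_deriv ?_
  have : t - K / t = (t ^ 2 - K) / t := by field_simp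
  rw [deriv_id'', this, sqrtE]
  field_simp

theorem deriv_const_div (t : ℝ) : deriv (fun s : ℝ => K / s) t = -(K / t ^ 2) := by
  simp only [div_eq_mul_inv, deriv_const_mul_field', deriv_inv]
  ring

theorem hasDerivAt_neg_log_sqrtG {t : ℝ} (h : 0 < t * (t ^ 2 - K)) :
    HasDerivAt (fun s => -Real.log (sqrtG K s)) (deriv (fun s : ℝ => K / s) t / (K / t - t)) t := by
  obtain ⟨ht, hN⟩ := mul_ne_zero_iff.1 h.ne'
  have hw := (radical_pos hN).ne'
  refine ((hasDerivAt_sqrtG hN).log (sqrtG_pos h).ne').neg.congr_deriv ?_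
  have : K / t - t = -((t ^ 2 - K) / t) := by field_simp; ring
  rw [deriv_const_div, this, sqrtG]
  field_simp

/-- A surface whose derivation equations have the canonical coefficients solves the problem. -/
theorem IsFramedSurface.isSolution (hK : K ≠ 0) (hD : IsOpen D) (hD' : IsConnected D)
    (hν : ContDiffOn ℝ ∞ ν D) (hpos : ∀ p ∈ D, 0 < ν p * (ν p ^ 2 - K))
    (hne : ∀ p ∈ D, du ν p * dv ν p ≠ 0) {x X Y l : ℝ × ℝ → E3} (hx : ContDiffOn ℝ ∞ x D)
    (h : IsFramedSurface (fun p => sqrtE K (ν p)) (fun p => sqrtG K (ν p))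
        (fun p => dv ν p * sqrtE K (ν p) ^ 2) (fun p => ν p * sqrtE K (ν p))
        (fun p => -(K * (du ν p * sqrtE K (ν p) ^ 2)))
        (fun p => K * (radical K (ν p) / (ν p ^ 2 - K))) x X Y l D)
    {p₀ : ℝ × ℝ} (hp₀ : p₀ ∈ D) : IsSolution K ν p₀ (x p₀) (X p₀) (Y p₀) (l p₀) x D := by
  have hν0 : ∀ p ∈ D, ν p ≠ 0 := fun p hp => (mul_ne_zero_iff.1 (hpos p hp).ne').1
  have hN : ∀ p ∈ D, ν p ^ 2 - K ≠ 0 := fun p hp => (mul_ne_zero_iff.1 (hpos p hp).ne').2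
  have hw0 : ∀ p ∈ D, radical K (ν p) ≠ 0 := fun p hp => (radical_pos (hN p hp)).ne'
  have hνd : ∀ p ∈ D, DifferentiableAt ℝ ν p := fun p hp =>
    (hν.contDiffAt (hD.mem_nhds hp)).differentiableAt (by simp)
  have hd₁ : ∀ p ∈ D, DifferentiableAt ℝ (fun p => sqrtE K (ν p)) p := fun p hp =>
    (hasDerivAt_sqrtE (hN p hp)).differentiableAt.fun_comp' p (hνd p hp)
  have hd₂ : ∀ p ∈ D, DifferentiableAt ℝ (fun p => sqrtG K (ν p)) p := fun p hp =>
    (hasDerivAt_sqrtG (hN p hp)).differentiableAt.fun_comp' p (hνd p hp)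
  have hs₁ : ∀ p ∈ D, 0 < sqrtE K (ν p) := fun p hp => sqrtE_pos (hN p hp)
  have hs₂ : ∀ p ∈ D, 0 < sqrtG K (ν p) := fun p hp => sqrtG_pos (hpos p hp)
  have hnu1 : ∀ p ∈ D, nu1 x p = ν p := fun p hp => by
    rw [h.nu1_eq hD hp (hd₁ p hp) (hs₁ p hp) (hs₂ p hp)]
    exact mul_div_cancel_right₀ _ (hs₁ p hp).ne'
  have hnu2 : ∀ p ∈ D, nu2 x p = K / ν p := fun p hp => by
    have h1 := hν0 p hp
    have h2 := hw0 p hp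
    have h3 := hN p hp
    rw [h.nu2_eq hD hp (hd₂ p hp) (hs₁ p hp) (hs₂ p hp), sqrtG]
    field_simp
  have hgauss : ∀ p ∈ D, gaussCurvature x p = K := fun p hp => by
    rw [h.gaussCurvature_eq hD hp (hd₁ p hp) (hd₂ p hp) (hs₁ p hp) (hs₂ p hp),
      ← h.nu1_eq hD hp (hd₁ p hp) (hs₁ p hp) (hs₂ p hp),
      ← h.nu2_eq hD hp (hd₂ p hp) (hs₁ p hp) (hs₂ p hp), hnu1 p hp, hnu2 p hp,
      mul_div_cancel₀ _ (hν0 p hp)]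
  have hgamma1 : ∀ p ∈ D, gamma1 x p = dv ν p / radical K (ν p) := fun p hp => by
    have h2 := hw0 p hp
    rw [h.gamma1_eq hD hp (hd₁ p hp) (hs₁ p hp) (hs₂ p hp), sqrtE]
    field_simp
  have hgamma2 : ∀ p ∈ D, gamma2 x p =
      -(Real.sign (ν p ^ 2 - K) * K * du ν p) / (ν p * radical K (ν p)) := fun p hp => by
    have h1 := hν0 p hp
    have h2 := hw0 p hp
    have h3 := hN p hp
    rw [h.gamma2_eq hD hp (hd₂ p hp) (hs₁ p hp) (hs₂ p hp), sqrtE_sq h3, sqrtG]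
    field_simp
  have hprin : IsPrincipalNet x D := fun p hp =>
    ⟨h.fF_eq hp, h.sM_eq hD hp (hd₁ p hp) (hs₁ p hp) (hs₂ p hp)⟩
  have hsub : ∀ p ∈ D, 0 < ν p - K / ν p := fun p hp => by
    have h1 := hν0 p hp
    have : ν p - K / ν p = ν p * (ν p ^ 2 - K) / ν p ^ 2 := by field_simp
    rw [this]
    have := hpos p hp
    positivity
  have hstrong : IsStronglyRegular x D := by
    refine ⟨h.isSurface hD hD' hx hs₁ hs₂, hprin, fun p hp => ?_⟩
    have hsg : Real.sign (ν p ^ 2 - K) ≠ 0 := fun h0 => by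
      have := sign_sq (hN p hp)
      rw [h0] at this
      norm_num at this
    obtain ⟨hu, hv⟩ := mul_ne_zero_iff.1 (hne p hp)
    rw [hnu1 p hp, hnu2 p hp, hgamma1 p hp, hgamma2 p hp]
    exact mul_ne_zero (mul_ne_zero (hsub p hp).ne' (div_ne_zero hv (hw0 p hp)))
      (div_ne_zero (neg_ne_zero.2 (mul_ne_zero (mul_ne_zero hsg hK) hu))
        (mul_ne_zero (hν0 p hp) (hw0 p hp)))
  -- The Weingarten conditions concern values of `nu1 x`, which is known to equal `ν` only on `D`.
  have himage : ∀ {P : ℝ → Prop}, (∀ p ∈ D, P (ν p)) → ∀ t ∈ nu1 x '' D, P t := by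
    rintro P hP _ ⟨p, hp, rfl⟩
    rw [hnu1 p hp]
    exact hP p hp
  have hfd : ∀ p ∈ D, fderiv ℝ (nu1 x) p = fderiv ℝ ν p := fun p hp =>
    Filter.EventuallyEq.fderiv_eq (eventually_of_mem (hD.mem_nhds hp) hnu1)
  have hwein : IsWeingarten (fun t => t) (fun t => K / t) (nu1 x) x D := by
    refine ⟨hstrong, fun p hp => rfl, fun p hp => by rw [hnu2 p hp, hnu1 p hp], ?_, ?_, ?_, ?_⟩
    · exact himage fun p hp => ⟨differentiableAt_id,
        (differentiableAt_const K).fun_div differentiableAt_id (hν0 p hp)⟩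
    · exact himage hsub
    · refine himage fun p hp => ?_
      rw [deriv_id'', deriv_const_div, one_mul]
      exact neg_ne_zero.2 (div_ne_zero hK (pow_ne_zero 2 (hν0 p hp)))
    · intro p hp
      rw [du, dv, hfd p hp]
      exact hne p hp
  have hgeom : IsGeometricPrincipal (fun t => t) (fun t => K / t) (nu1 x) x D := by
    refine ⟨hwein, fun t => -Real.log (sqrtE K t), fun t => -Real.log (sqrtG K t),
      himage fun p hp => hasDerivAt_neg_log_sqrtE (hN p hp),
      himage fun p hp => hasDerivAt_neg_log_sqrtG (hpos p hp), ⟨0, fun p hp => ?_⟩,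
      ⟨0, fun p hp => ?_⟩⟩
    · rw [hnu1 p hp, h.fE_eq hp, Real.sqrt_sq (hs₁ p hp).le, Real.exp_neg,
        Real.exp_log (hs₁ p hp), mul_inv_cancel₀ (hs₁ p hp).ne', Real.log_one]
    · rw [hnu1 p hp, h.fG_eq hp, Real.sqrt_sq (hs₂ p hp).le, Real.exp_neg,
        Real.exp_log (hs₂ p hp), mul_inv_cancel₀ (hs₂ p hp).ne', Real.log_one]
  refine ⟨hstrong, ⟨hgeom, fun p hp => ?_, fun p hp => ?_⟩, rfl,
    h.frameX_eq hp₀ (hs₁ p₀ hp₀), h.frameY_eq hp₀ (hs₂ p₀ hp₀),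
    h.normal_eq hp₀ (hs₁ p₀ hp₀) (hs₂ p₀ hp₀), hgauss, hnu1, hnu2, ?_, ?_⟩
  · rw [hnu1 p hp, h.fE_eq hp, sqrtE_sq (hN p hp)]
  · rw [hnu1 p hp, h.fG_eq hp, sqrtG_sq (hN p hp)]
  · simpa only [sqrt_sign_mul] using hgamma1
  · simpa only [sqrt_sign_mul] using hgamma2

/-- The derivation equations of a solution have the canonical coefficients. -/
theorem IsSolution.isFramedSurface (hpos : ∀ p ∈ D, 0 < ν p * (ν p ^ 2 - K)) {p₀ : ℝ × ℝ}
    {x₀ X₀ Y₀ l₀ : E3} {x : ℝ × ℝ → E3} (h : IsSolution K ν p₀ x₀ X₀ Y₀ l₀ x D) :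
    IsFramedSurface (fun p => sqrtE K (ν p)) (fun p => sqrtG K (ν p))
        (fun p => dv ν p * sqrtE K (ν p) ^ 2) (fun p => ν p * sqrtE K (ν p))
        (fun p => -(K * (du ν p * sqrtE K (ν p) ^ 2)))
        (fun p => K * (radical K (ν p) / (ν p ^ 2 - K))) x (frameX x) (frameY x) (normal x) D := by
  have hν0 : ∀ p ∈ D, ν p ≠ 0 := fun p hp => (mul_ne_zero_iff.1 (hpos p hp).ne').1
  have hN : ∀ p ∈ D, ν p ^ 2 - K ≠ 0 := fun p hp => (mul_ne_zero_iff.1 (hpos p hp).ne').2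
  have hw0 : ∀ p ∈ D, radical K (ν p) ≠ 0 := fun p hp => (radical_pos (hN p hp)).ne'
  -- The normalization of `E` and `G` fixes their positive roots in terms of `ν`; the curvature
  -- formulas then determine the four connection coefficients.
  have hE : ∀ p ∈ D, √(fE x p) = sqrtE K (ν p) := fun p hp => by
    rw [h.canonical.coeff_E p hp, h.inv_nu1 p hp, ← sqrtE_sq (hN p hp),
      Real.sqrt_sq (sqrtE_pos (hN p hp)).le]
  have hG : ∀ p ∈ D, √(fG x p) = sqrtG K (ν p) := fun p hp => by
    rw [h.canonical.coeff_G p hp, h.inv_nu1 p hp, ← sqrtG_sq (hN p hp),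
      Real.sqrt_sq (sqrtG_pos (hpos p hp)).le]
  refine (isFramedSurface_of_isPrincipalNet h.stronglyRegular.isSurface
    h.stronglyRegular.principal).congr hE hG (fun p hp => ?_) (fun p hp => ?_) (fun p hp => ?_)
    (fun p hp => ?_)
  · have h1 := hw0 p hp
    simp only [hE p hp, h.inv_gamma1 p hp, sqrt_sign_mul, sqrtE]
    field_simp
  · simp only [hE p hp, h.inv_nu1 p hp]
    ring
  · have h1 := hw0 p hp
    have h2 := hν0 p hp
    have h3 := hN p hp
    simp only [hG p hp, h.inv_gamma2 p hp, sqrt_sign_mul, sqrtE_sq h3, sqrtG]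
    field_simp
  · have h2 := hν0 p hp
    have h3 := hN p hp
    simp only [hG p hp, h.inv_nu2 p hp, sqrtG]
    field_simp

end Solutions

end CanonicalSurface

end

/-! ### Existence and uniqueness of the surface. -/

theorem corollary5p4 (K : ℝ) (hK : K = 1 ∨ K = -1)
    (D : Set (ℝ × ℝ)) (hD : IsOpen D) (p₀ : ℝ × ℝ) (hp₀ : p₀ ∈ D)
    (ν : ℝ × ℝ → ℝ) (hν : ContDiffOn ℝ ∞ ν D)
    (hpos : ∀ p ∈ D, 0 < ν p * (ν p ^ 2 - K))
    (hne : ∀ p ∈ D, CanonicalSurface.du ν p * CanonicalSurface.dv ν p ≠ 0)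
    (hpde : ∀ p ∈ D,
      CanonicalSurface.dv (CanonicalSurface.dv ν) p
          + K * CanonicalSurface.du (CanonicalSurface.du ν) p
          - 2 * ν p / (ν p ^ 2 - K)
            * (CanonicalSurface.dv ν p ^ 2 + K * CanonicalSurface.du ν p ^ 2)
        = Real.sign (ν p ^ 2 - K) * K * ν p)
    (x₀ X₀ Y₀ l₀ : CanonicalSurface.E3) (hframe : CanonicalSurface.IsRightFrame X₀ Y₀ l₀) :
    (∃ D₀ : Set (ℝ × ℝ), p₀ ∈ D₀ ∧ D₀ ⊆ D ∧
      ∃ x : ℝ × ℝ → CanonicalSurface.E3,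
        CanonicalSurface.IsSolution K ν p₀ x₀ X₀ Y₀ l₀ x D₀) ∧
    (∀ D₁ : Set (ℝ × ℝ), p₀ ∈ D₁ → D₁ ⊆ D →
      ∀ x y : ℝ × ℝ → CanonicalSurface.E3,
        CanonicalSurface.IsSolution K ν p₀ x₀ X₀ Y₀ l₀ x D₁ →
        CanonicalSurface.IsSolution K ν p₀ x₀ X₀ Y₀ l₀ y D₁ →
        Set.EqOn x y D₁) := by
  have hK0 : K ≠ 0 := by rcases hK with rfl | rfl <;> norm_num
  constructor
  · obtain ⟨R, hR, hsub, x, X, Y, l, rfl, rfl, rfl, rfl, hx, h⟩ :=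
      CanonicalSurface.exists_isFramedSurface_of_canonical_equation hD hp₀ hν
        (fun p hp => (mul_ne_zero_iff.1 (hpos p hp).ne').2) hpde x₀ X₀ Y₀ l₀ hframe
    have hp₀' := Metric.mem_ball_self (x := p₀) hR
    exact ⟨Metric.ball p₀ R, hp₀', hsub, x, h.isSolution hK0 Metric.isOpen_ball
      ⟨⟨p₀, hp₀'⟩, (convex_ball p₀ R).isPreconnected⟩ (hν.mono hsub)
      (fun p hp => hpos p (hsub hp)) (fun p hp => hne p (hsub hp)) hx hp₀'⟩
  · intro D₁ hp₁ hsub x y hx hy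
    have hpos₁ : ∀ p ∈ D₁, 0 < ν p * (ν p ^ 2 - K) := fun p hp => hpos p (hsub hp)
    -- Both surfaces satisfy the same linear system with the same initial frame, and `D₁` is open
    -- and connected as the domain of a surface.
    exact (hx.isFramedSurface hpos₁).eqOn (hy.isFramedSurface hpos₁)
      hx.stronglyRegular.isSurface.isOpen
      hx.stronglyRegular.isSurface.isConnected.isPreconnected hp₁
      (hx.init_x.trans hy.init_x.symm) (hx.init_X.trans hy.init_X.symm)
      (hx.init_Y.trans hy.init_Y.symm) (hx.init_l.trans hy.init_l.symm)
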